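/- **Theorem 3.1 (ends).** Let $G=(V,E)$ be a connected, locally finite graph whose automorphism group $\mathrm{Aut}(G)$ has finitely many orbits on $V$ ($G$ is quasitransitive) and which is unimodular: $|\mathrm{Stab}(x)\,y|=|\mathrm{Stab}(y)\,x|$ whenever $x,y\in V$ lie in the same orbit, where $\mathrm{Stab}(x)\subseteq\mathrm{Aut}(G)$ is the stabilizer of $x$. Let $\mathbf P$ be the law, on $2^E$ with the product $\sigma$-algebra, of a random spanning forest $\mathcal F$ of $G$; that is, for $\mathbf P$-almost every $\omega\subseteq E$ the graph $(V,\omega)$ has no cycle. For $x\in V$ let $C_x=C_x(\omega)$ be the connected component of $x$ in $(V,\omega)$. Suppose that: * *(ergodicity)* $\mathbf P$ is $\mathrm{Aut}(G)$-invariant, and every $\mathrm{Aut}(G)$-invariant event has probability $0$ or $1$; * *(weak insertion tolerance)* for every edge $e=\{x,y\}\in E$, every choice of the endpoint $x$ of $e$ and every integer $r\ge 0$ there is a measurable map $\omega\mapsto f(\omega)=f(\omega,e,x,r)\in E\cup\{\emptyset\}$, defined on the event $\{C_x\neq C_y\}$, such that (i) for every event $A$ with $\mathbf P(A)>0$ on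 which $C_x\ne C_y$ almost surely, the event $\{(\omega\cup\{e\})\setminus \{f(\omega)\}:\omega\in A\}$ has positive probability (if $f(\omega)=\emptyset$, nothing is deleted); (ii) almost surely on $\{C_x\neq C_y\}$, if $f(\omega)\neq\emptyset$, then $f(\omega)$ is an edge of $C_x$ at distance more than $r$ from $x$ in $G$ (the distance from $x$ to an edge being the minimum of the distances to its endpoints). If with positive probability some component of $\mathcal F$ has infinitely many ends, then almost surely every infinite component of $\mathcal F$ has infinitely many ends. In particular, if all components of $\mathcal F$ are infinite, then almost surely every component has infinitely many ends. -/

import Mathlib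

open MeasureTheory

namespace RandomForest

variable {V : Type*}

/-- A bond configuration: a set of (open) edges of `G`.  Configurations carry Mathlib's product
σ-algebra on `Set`, generated by the events `{ω | g ∈ ω}`. -/
abbrev Config (G : SimpleGraph V) : Type _ := Set G.edgeSet

/-- The spanning subgraph of `G` whose edges are the open edges of `ω`. -/
def graph {G : SimpleGraph V} (ω : Config G) : SimpleGraph V :=
  SimpleGraph.fromEdgeSet (Subtype.val '' ω)

/-- A connected graph component has infinitely many ends (ends of its underlying graph). -/
def HasInfinitelyManyEnds {H : SimpleGraph V} (C : H.ConnectedComponent) : Prop :=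
  C.toSimpleGraph.end.Infinite

/-- `G` is quasitransitive: its automorphism group has finitely many orbits of vertices. -/
def IsQuasitransitive (G : SimpleGraph V) : Prop :=
  ∃ S : Set V, S.Finite ∧ ∀ v : V, ∃ s ∈ S, ∃ φ : G ≃g G, φ s = v

/-- `G` is unimodular: writing `Stab x` for the stabilizer of `x` in the automorphism group of `G`,
`|Stab x · y| = |Stab y · x|` whenever `x` and `y` lie in the same orbit. -/
def IsUnimodular (G : SimpleGraph V) : Prop :=
  ∀ x y : V, (∃ φ : G ≃g G, φ x = y) →
    {z : V | ∃ φ : G ≃g G, φ x = x ∧ φ y = z}.encard =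
      {z : V | ∃ φ : G ≃g G, φ y = y ∧ φ x = z}.encard

/-- The action of an automorphism of `G` on configurations. -/
def act {G : SimpleGraph V} (φ : G ≃g G) (ω : Config G) : Config G :=
  φ.mapEdgeSet '' ω

/-- `P` is the law of a random spanning forest of `G`: almost surely there are no cycles.
The forest spans because `graph ω` has all vertices of `G`. -/
def IsSpanningForest {G : SimpleGraph V} (P : Measure (Config G)) : Prop :=
  ∀ᵐ ω ∂P, (graph ω).IsAcyclic

/-- The law `P` is invariant under all automorphisms of `G`, and every event that is invariant under
all automorphisms has probability `0` or `1`. -/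
structure IsErgodic {G : SimpleGraph V} (P : Measure (Config G)) : Prop where
  invariant : ∀ φ : G ≃g G, MeasurePreserving (act φ) P P
  zero_or_one : ∀ A : Set (Config G), MeasurableSet A →
    (∀ φ : G ≃g G, act φ ⁻¹' A = A) → P A = 0 ∨ P A = 1

/-- The surgery `ω ∪ {e} \ {f}`, where `f = none` means that no edge is deleted. -/
def surgery {G : SimpleGraph V} (e : G.edgeSet) (f : Option G.edgeSet) (ω : Config G) : Config G :=
  (ω ∪ {e}) \ {g | f = some g}

/-- Weak insertion tolerance of the law `P` of a random forest of `G`.  The function `f` is only used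
on the (measurable) event that `x` and `y` are in different components; its values elsewhere are
irrelevant.  The target of `f` is countable and carries the discrete σ-algebra.  An edge lies outside
the ball of radius `r` around `x` if its distance from `x`, the minimum over its endpoints,
exceeds `r`. -/
def IsWeaklyInsertionTolerant {G : SimpleGraph V} (P : Measure (Config G)) : Prop :=
  ∀ (x y : V) (hxy : G.Adj x y) (r : ℕ),
    ∃ f : Config G → Option G.edgeSet,
      Measurable[inferInstance, ⊤] f ∧
      (∀ A : Set (Config G), MeasurableSet A → 0 < P A →
        (∀ᵐ ω ∂P, ω ∈ A → ¬ (graph ω).Reachable x y) →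
        0 < P ((fun ω => surgery ⟨s(x, y), hxy⟩ (f ω) ω) '' A)) ∧
      (∀ᵐ ω ∂P, ¬ (graph ω).Reachable x y →
        ∀ g : G.edgeSet, f ω = some g →
          g ∈ ω ∧ ∀ v ∈ (g : Sym2 V), (graph ω).Reachable x v ∧ r < G.dist x v)

end RandomForest

/-! Two local features of a component are played against each other: a trifurcation (a finite
connected set whose removal leaves at least three infinite pieces) and an isolated end (a one-ended
branch). In a locally finite forest every infinite component has one of them: infinitely many ends
give a trifurcation around each vertex (`hasTrifurcation_of_end_infinite`), and otherwise a branch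
with as few ends as possible is one-ended (`hasIsolatedEnd_of_end_finite`). Nothing is needed in the
converse direction.

Both features cannot occur in one component. Otherwise some trifurcation vertex `z` has an infinite
branch free of trifurcation vertices (`IsAcyclic.exists_infinite_sendsMass`). Let every vertex of
such a branch send mass one to `z`. The receiver is unique, so at most one unit leaves each vertex,
while `z` receives infinite mass; the mass transport principle excludes this almost surely
(`tsum_incoming_ne_top`, `ae_not_reachable`).

Nor can they occur in different components (`measure_coexistence_eq_zero`), by induction on the
distance in `G` between `x`, in a component with an isolated end, and `y`, in one with a
trifurcation. If `x` and `y` are adjacent, inserting the edge between them merges the components,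
and an edge deleted far away spoils at most one of the three pieces at `y`, which the component of
`x` replaces (`measure_adj_eq_zero`). If they are farther apart, take a neighbour `q` of `y` closer
to `x`. An infinite component at `q` reduces to the adjacent case or to the induction hypothesis; a
finite one is glued to `y`, so that `q` takes the place of `y` (`measure_finite_eq_zero`).

By ergodicity a trifurcation exists almost surely. Hence no isolated end exists, and every infinite
component has infinitely many ends. -/

namespace SimpleGraph

variable {V W : Type*}

/-! ### Vertex deletion and branches of forests -/

/-- The graph obtained from `H` by isolating the vertices of `K`. -/
def avoid (H : SimpleGraph V) (K : Set V) : SimpleGraph V where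
  Adj a b := H.Adj a b ∧ a ∉ K ∧ b ∉ K
  symm := ⟨fun _ _ h => ⟨h.1.symm, h.2.2, h.2.1⟩⟩
  loopless := ⟨fun _ h => h.1.ne rfl⟩

/-- The set of vertices reachable from `a` in `H`. -/
def reachSet (H : SimpleGraph V) (a : V) : Set V := {b | H.Reachable a b}

theorem avoid_adj {H : SimpleGraph V} {K : Set V} {a b : V} :
    (H.avoid K).Adj a b ↔ H.Adj a b ∧ a ∉ K ∧ b ∉ K := Iff.rfl

theorem mem_reachSet {H : SimpleGraph V} {a b : V} : b ∈ H.reachSet a ↔ H.Reachable a b := Iff.rfl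

theorem avoid_le (H : SimpleGraph V) (K : Set V) : H.avoid K ≤ H := fun _ _ h => h.1

theorem avoid_anti (H : SimpleGraph V) {K L : Set V} (h : K ⊆ L) : H.avoid L ≤ H.avoid K :=
  fun _ _ h' => ⟨h'.1, fun hK => h'.2.1 (h hK), fun hK => h'.2.2 (h hK)⟩

theorem avoid_avoid (H : SimpleGraph V) (K L : Set V) :
    (H.avoid K).avoid L = H.avoid (K ∪ L) := by
  ext a b
  simp only [avoid_adj, Set.mem_union]
  tauto

theorem Reachable.induction_on {H : SimpleGraph V} {a b : V} {p : V → Prop}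
    (h : H.Reachable a b) (ha : p a)
    (step : ∀ c d, H.Reachable a c → H.Adj c d → p c → p d) : p b := by
  have h' := (H.reachable_iff_reflTransGen a b).1 h
  clear h
  induction h' with
  | refl => exact ha
  | tail hab hbc ih => exact step _ _ ((H.reachable_iff_reflTransGen _ _).2 hab) hbc ih

theorem Reachable.transfer_of_forall {H H' : SimpleGraph V} {a b : V} (h : H.Reachable a b)
    (hH : ∀ c, H.Reachable a c → ∀ d, H.Adj c d → H'.Adj c d) : H'.Reachable a b :=
  h.induction_on (p := fun b => H'.Reachable a b) .rfl
    fun c d hc hcd ih => ih.trans (hH c hc d hcd).reachable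

/-- Only edges at vertices already reached matter, so the graphs may differ arbitrarily elsewhere.
This is how branches are shown to survive edge surgery or a change of the deleted set. -/
theorem reachSet_congr {H H' : SimpleGraph V} {a : V}
    (h : ∀ b ∈ H.reachSet a, ∀ c, H.Adj b c ↔ H'.Adj b c) : H.reachSet a = H'.reachSet a := by
  ext b
  constructor
  · exact fun hb => Reachable.transfer_of_forall hb fun c hc d => (h c hc d).1
  · exact fun hb => Reachable.induction_on (p := fun b => H.Reachable a b) hb .rfl
      fun c d _ hcd ih => ih.trans ((h c ih d).2 hcd).reachable

/-- Vertices of `K` remain in `H.avoid K` as isolated vertices, so each reaches only itself. -/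
theorem notMem_of_infinite_reachSet {H : SimpleGraph V} {K : Set V} {a : V}
    (h : ((H.avoid K).reachSet a).Infinite) : a ∉ K := by
  intro ha
  refine h ((Set.finite_singleton a).subset fun b hb => ?_)
  refine Reachable.induction_on (p := fun b => b ∈ ({a} : Set V)) hb rfl ?_
  rintro c d - hcd rfl
  exact absurd ha hcd.2.1

theorem Reachable.notMem_of_avoid {H : SimpleGraph V} {K : Set V} {a b : V}
    (h : (H.avoid K).Reachable a b) (ha : a ∉ K) : b ∉ K :=
  h.induction_on (p := fun b => b ∉ K) ha fun _ _ _ hcd _ => hcd.2.2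

theorem Walk.reachable_avoid {H : SimpleGraph V} {K : Set V} {a b : V} (p : H.Walk a b)
    (h : ∀ v ∈ p.support, v ∉ K) : (H.avoid K).Reachable a b := by
  induction p with
  | nil => exact .rfl
  | cons hadj p ih =>
    simp only [Walk.support_cons, List.mem_cons, forall_eq_or_imp] at h
    exact (Adj.reachable (G := H.avoid K)
      ⟨hadj, h.1, h.2 _ p.start_mem_support⟩).trans (ih h.2)

/-- A path from `u` to another vertex leaves `u` through a neighbour and never returns. -/
theorem Reachable.exists_adj_avoid {H : SimpleGraph V} {u t : V} (h : H.Reachable u t)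
    (hne : t ≠ u) : ∃ c, H.Adj u c ∧ (H.avoid {u}).Reachable c t := by
  obtain ⟨p, hp⟩ := h.exists_isPath
  cases p with
  | nil => exact absurd rfl hne
  | cons hadj p =>
    rw [Walk.cons_isPath_iff] at hp
    exact ⟨_, hadj, p.reachable_avoid fun v hv hvu => hp.2 (hvu ▸ hv)⟩

/-- In a forest, distinct neighbours of `k` are separated by `k`. -/
theorem IsAcyclic.not_reachable_avoid {H : SimpleGraph V} (hH : H.IsAcyclic) {k a b : V}
    (ha : H.Adj k a) (hb : H.Adj k b) (hab : a ≠ b) : ¬ (H.avoid {k}).Reachable a b := by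
  intro h
  have hbr := isAcyclic_iff_forall_adj_isBridge.1 hH ha
  rw [isBridge_iff] at hbr
  refine hbr (Reachable.symm ?_)
  have h1 : (H.deleteEdges {s(k, a)}).Reachable a b := by
    refine h.mono fun c d hcd => ?_
    rw [deleteEdges_adj]
    refine ⟨hcd.1, ?_⟩
    have h1 := hcd.2.1
    have h2 := hcd.2.2
    simp only [Set.mem_singleton_iff] at h1 h2
    simp [h1, h2]
  refine h1.trans (Adj.reachable ?_)
  rw [deleteEdges_adj]
  refine ⟨hb.symm, ?_⟩
  simp [hab.symm, hb.ne']

theorem IsAcyclic.avoid {H : SimpleGraph V} (hH : H.IsAcyclic) (K : Set V) :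
    (H.avoid K).IsAcyclic := hH.anti (H.avoid_le K)

/-- If a branch `B` at `t` does not contain `u`, then `B` is contained in each branch at `u`
that contains `t`. -/
theorem reachable_avoid_of_not_reachable {H : SimpleGraph V} {t w b c : V} {K : Set V}
    (htw : H.Adj t w) (hu : ∀ u ∈ K, ¬ (H.avoid {t}).Reachable w u)
    (hct : (H.avoid K).Reachable c t) (htK : t ∉ K)
    (hwb : (H.avoid {t}).Reachable w b) : (H.avoid K).Reachable c b := by
  have hwK : w ∉ K := fun h => hu w h .rfl
  refine hct.trans ((Adj.reachable (G := H.avoid K) ⟨htw, htK, hwK⟩).trans ?_)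
  refine hwb.transfer_of_forall fun p hp q hpq => ⟨hpq.1, fun h => hu p h hp, fun h => ?_⟩
  exact hu q h (hp.trans hpq.reachable)

/-! ### Trifurcations, one-ended branches and the transport -/

/-- Removing `K` leaves three distinct infinite components adjacent to `K`. -/
def IsTrifurcating (H : SimpleGraph V) (K : Set V) : Prop :=
  ∃ a : Fin 3 → V, (∀ i, ∃ k ∈ K, H.Adj k (a i)) ∧
    (∀ i, ((H.avoid K).reachSet (a i)).Infinite) ∧
    ∀ i j, i ≠ j → ¬ (H.avoid K).Reachable (a i) (a j)

/-- Some finite connected set containing `y` is trifurcating. -/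
def HasTrifurcation (H : SimpleGraph V) (y : V) : Prop :=
  ∃ K : Finset V, y ∈ K ∧ (∀ a ∈ K, ∀ b ∈ K, (H.avoid (K : Set V)ᶜ).Reachable a b) ∧
    H.IsTrifurcating K

/-- The component of `v` in `L` is infinite, and no vertex splits it into more than one infinite
part. -/
def IsOneEndedFrom (L : SimpleGraph V) (v : V) : Prop :=
  (L.reachSet v).Infinite ∧ ∀ a ∈ L.reachSet v, ∀ c d, L.Adj a c → L.Adj a d →
    ((L.avoid {a}).reachSet c).Infinite → ((L.avoid {a}).reachSet d).Infinite → c = d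

/-- The component of `x` has a one-ended branch not containing `x`. -/
def HasIsolatedEnd (H : SimpleGraph V) (x : V) : Prop :=
  ∃ u v, H.Adj u v ∧ H.Reachable x u ∧ ¬ (H.avoid {u}).Reachable v x ∧
    (H.avoid {u}).IsOneEndedFrom v

/-- `x` lies in an infinite branch at the trifurcation vertex `z` that contains no trifurcation
vertex. -/
def SendsMass (H : SimpleGraph V) (x z : V) : Prop :=
  H.IsTrifurcating {z} ∧ ∃ w, H.Adj z w ∧ ((H.avoid {z}).reachSet w).Infinite ∧
    (∀ t, (H.avoid {z}).Reachable w t → ¬ H.IsTrifurcating {t}) ∧ (H.avoid {z}).Reachable w x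

theorem isOneEndedFrom_of_congr {L L' : SimpleGraph V} {v : V}
    (h : ∀ b ∈ L.reachSet v, ∀ c, L.Adj b c ↔ L'.Adj b c) (hL : L.IsOneEndedFrom v) :
    L'.IsOneEndedFrom v := by
  have hv := reachSet_congr h
  refine ⟨hv ▸ hL.1, fun a ha c d hac had hc hd => ?_⟩
  rw [← hv] at ha
  have key : ∀ c, L'.Adj a c → (L.avoid {a}).reachSet c = (L'.avoid {a}).reachSet c := by
    intro c hac
    refine reachSet_congr fun b hb e => ?_
    rw [avoid_adj, avoid_adj, h b ?_ e]
    exact ha.trans (((h a ha c).2 hac).reachable.trans (hb.mono (avoid_le _ _)))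
  exact hL.2 a ha c d ((h a ha c).2 hac) ((h a ha d).2 had) (key c hac ▸ hc) (key d had ▸ hd)

theorem isTrifurcating_of_three {H : SimpleGraph V} {K : Set V} {a b c : V}
    (ha : ∃ k ∈ K, H.Adj k a) (hb : ∃ k ∈ K, H.Adj k b) (hc : ∃ k ∈ K, H.Adj k c)
    (ha' : ((H.avoid K).reachSet a).Infinite) (hb' : ((H.avoid K).reachSet b).Infinite)
    (hc' : ((H.avoid K).reachSet c).Infinite) (hab : ¬ (H.avoid K).Reachable a b)
    (hac : ¬ (H.avoid K).Reachable a c) (hbc : ¬ (H.avoid K).Reachable b c) :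
    H.IsTrifurcating K := by
  refine ⟨![a, b, c], fun i => ?_, fun i => ?_, fun i j hij => ?_⟩
  · fin_cases i <;> assumption
  · fin_cases i <;> assumption
  · fin_cases i <;> fin_cases j <;>
      first
      | exact absurd rfl hij
      | assumption
      | (rw [reachable_comm]; assumption)

/-- Separation is automatic in a forest: a connection between two neighbours of `k` that avoids `k`
would close a cycle. -/
theorem IsAcyclic.isTrifurcating_singleton {H : SimpleGraph V} (hH : H.IsAcyclic) {k a b c : V}
    (ha : H.Adj k a) (hb : H.Adj k b) (hc : H.Adj k c) (hab : a ≠ b) (hac : a ≠ c) (hbc : b ≠ c)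
    (ha' : ((H.avoid {k}).reachSet a).Infinite) (hb' : ((H.avoid {k}).reachSet b).Infinite)
    (hc' : ((H.avoid {k}).reachSet c).Infinite) : H.IsTrifurcating {k} :=
  isTrifurcating_of_three ⟨k, rfl, ha⟩ ⟨k, rfl, hb⟩ ⟨k, rfl, hc⟩ ha' hb' hc'
    (hH.not_reachable_avoid ha hb hab) (hH.not_reachable_avoid ha hc hac)
    (hH.not_reachable_avoid hb hc hbc)

theorem exists_pair_not_of_pairwise {p : Fin 3 → Prop} (h : ∀ i j, i ≠ j → p i → ¬ p j) :
    ∃ i j, i ≠ j ∧ ¬ p i ∧ ¬ p j := by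
  by_cases h0 : p 0
  · exact ⟨1, 2, by decide, h 0 1 (by decide) h0, h 0 2 (by decide) h0⟩
  · by_cases h1 : p 1
    · exact ⟨0, 2, by decide, h0, h 1 2 (by decide) h1⟩
    · exact ⟨0, 1, by decide, h0, h1⟩

/-- At least two infinite branches at a trifurcation vertex do not contain a given vertex. -/
theorem IsTrifurcating.exists_avoiding {H : SimpleGraph V} {t : V} (h : H.IsTrifurcating {t})
    (u : V) : ∃ c d, c ≠ d ∧ H.Adj t c ∧ H.Adj t d ∧ ((H.avoid {t}).reachSet c).Infinite ∧
      ((H.avoid {t}).reachSet d).Infinite ∧ ¬ (H.avoid {t}).Reachable c u ∧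
      ¬ (H.avoid {t}).Reachable d u := by
  obtain ⟨a, hadj, hinf, hsep⟩ := h
  have hadj' : ∀ i, H.Adj t (a i) := fun i => by
    obtain ⟨k, rfl, hk⟩ := hadj i
    exact hk
  obtain ⟨i, j, hij, hi, hj⟩ := exists_pair_not_of_pairwise
    (p := fun i => (H.avoid {t}).Reachable (a i) u) fun i j hij hi hj =>
      hsep i j hij (hi.trans hj.symm)
  exact ⟨a i, a j, fun h => hsep i j hij (h ▸ .rfl), hadj' i, hadj' j, hinf i, hinf j, hi, hj⟩

theorem reachable_avoid_compl_of_induce {H : SimpleGraph V} {K : Set V}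
    (h : (H.induce K).Preconnected) {a b : V} (ha : a ∈ K) (hb : b ∈ K) :
    (H.avoid Kᶜ).Reachable a b := by
  let f : H.induce K →g H.avoid Kᶜ :=
    ⟨Subtype.val, fun {p q} hpq => ⟨hpq, fun h => h p.2, fun h => h q.2⟩⟩
  exact (h ⟨a, ha⟩ ⟨b, hb⟩).map f

theorem induce_preconnected_of_avoid_compl {H : SimpleGraph V} {K : Set V}
    (h : ∀ a ∈ K, ∀ b ∈ K, (H.avoid Kᶜ).Reachable a b) : (H.induce K).Preconnected := by
  rintro ⟨a, ha⟩ ⟨b, hb⟩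
  suffices ∃ hb : b ∈ K, (H.induce K).Reachable ⟨a, ha⟩ ⟨b, hb⟩ from this.2
  refine (h a ha b hb).induction_on
    (p := fun b => ∃ hb : b ∈ K, (H.induce K).Reachable ⟨a, ha⟩ ⟨b, hb⟩) ⟨ha, .rfl⟩ ?_
  rintro c d - hcd ⟨hc, hac⟩
  have hd : d ∈ K := not_not.1 hcd.2.2
  exact ⟨hd, hac.trans (Adj.reachable (G := H.induce K) (u := ⟨c, hc⟩) (v := ⟨d, hd⟩) hcd.1)⟩

/-- A finite connected set with at least two vertices has a vertex whose removal leaves it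
connected. -/
theorem exists_erase_connected [DecidableEq V] {H : SimpleGraph V} {K : Finset V}
    (hK : ∀ a ∈ K, ∀ b ∈ K, (H.avoid (K : Set V)ᶜ).Reachable a b) (hcard : K.Nontrivial) :
    ∃ k ∈ K, ∀ a ∈ K.erase k, ∀ b ∈ K.erase k,
      (H.avoid ((K.erase k : Finset V) : Set V)ᶜ).Reachable a b := by
  have hpre : (H.induce (K : Set V)).Preconnected := induce_preconnected_of_avoid_compl hK
  obtain ⟨x, hx⟩ := hcard.nonempty
  have : Nontrivial (K : Set V) := Set.nontrivial_coe_sort.2 hcard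
  have hconn : (H.induce (K : Set V)).Connected := ⟨hpre⟩
  obtain ⟨⟨k, hk⟩, hv⟩ := hconn.exists_connected_induce_compl_singleton_of_finite_nontrivial
  refine ⟨k, hk, fun a ha b hb => ?_⟩
  let f : (H.induce (K : Set V)).induce {(⟨k, hk⟩ : (K : Set V))}ᶜ →g
      H.avoid ((K.erase k : Finset V) : Set V)ᶜ :=
    ⟨fun p => p.1.1, fun {p q} hpq => ⟨hpq, fun h => h ?_, fun h => h ?_⟩⟩
  · rw [Finset.mem_erase] at ha hb
    exact (hv.preconnected ⟨⟨a, ha.2⟩, fun h => ha.1 (congrArg Subtype.val h)⟩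
      ⟨⟨b, hb.2⟩, fun h => hb.1 (congrArg Subtype.val h)⟩).map f
  · exact Finset.mem_coe.2 (Finset.mem_erase.2 ⟨fun h => p.2 (Subtype.ext h), p.1.2⟩)
  · exact Finset.mem_coe.2 (Finset.mem_erase.2 ⟨fun h => q.2 (Subtype.ext h), q.1.2⟩)

/-- A piece of the complement of `K` not adjacent to `k` is unchanged when `k` is put back. -/
theorem reachSet_avoid_erase [DecidableEq V] {H : SimpleGraph V} {K : Finset V} {k a : V}
    (h : ∀ b ∈ (H.avoid (K : Set V)).reachSet a, ¬ H.Adj k b) (ha : a ∉ K) :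
    (H.avoid (K : Set V)).reachSet a = (H.avoid ((K.erase k : Finset V) : Set V)).reachSet a := by
  refine reachSet_congr fun b hb c => ?_
  have hbK : b ∉ (K : Set V) := Reachable.notMem_of_avoid hb ha
  simp only [avoid_adj, Finset.mem_coe, Finset.mem_erase] at hbK ⊢
  refine and_congr_right fun hbc => ?_
  have : c ≠ k := fun hck => h b hb (hck ▸ hbc.symm)
  tauto

theorem avoid_reachable_erase [DecidableEq V] {H : SimpleGraph V} {K : Finset V} {k a b : V}
    (h : ∀ b ∈ (H.avoid (K : Set V)).reachSet a, ¬ H.Adj k b) (ha : a ∉ K) :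
    (H.avoid ((K.erase k : Finset V) : Set V)).Reachable a b ↔
      (H.avoid (K : Set V)).Reachable a b := by
  have := Set.ext_iff.1 (reachSet_avoid_erase h ha) b
  exact this.symm

/-- In a forest, a finite connected trifurcating set contains a trifurcation vertex. -/
theorem IsAcyclic.exists_isTrifurcating_singleton {H : SimpleGraph V} (hH : H.IsAcyclic) :
    ∀ (n : ℕ) (K : Finset V), K.card = n →
      (∀ a ∈ K, ∀ b ∈ K, (H.avoid (K : Set V)ᶜ).Reachable a b) →
      H.IsTrifurcating K → ∃ z ∈ K, H.IsTrifurcating {z} := by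
  classical
  intro n
  induction n with
  | zero =>
    rintro K hK - ⟨a, hadj, -, -⟩
    obtain ⟨k, hk, -⟩ := hadj 0
    rw [Finset.card_eq_zero] at hK
    simp [hK] at hk
  | succ n ih =>
    intro K hcard hconn htri
    rcases n.eq_zero_or_pos with rfl | hn
    · obtain ⟨z, rfl⟩ := Finset.card_eq_one.1 (by simpa using hcard)
      exact ⟨z, by simp, by simpa using htri⟩
    have hnt : K.Nontrivial := Finset.one_lt_card_iff_nontrivial.1 (by omega)
    obtain ⟨k, hk, herase⟩ := exists_erase_connected hconn hnt
    obtain ⟨a, hadj, hinf, hsep⟩ := htri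
    have haK : ∀ i, a i ∉ K := fun i => notMem_of_infinite_reachSet (hinf i)
    -- a neighbour of `k` inside `K`
    obtain ⟨c, hcK, hkc⟩ : ∃ c ∈ K.erase k, H.Adj k c := by
      obtain ⟨x, hx, hxk⟩ := hnt.exists_ne k
      obtain ⟨c, hc, -⟩ := (hconn k hk x hx).exists_adj_avoid hxk
      exact ⟨c, Finset.mem_erase.2 ⟨hc.1.ne', not_not.1 hc.2.2⟩, hc.1⟩
    -- `T i` says that `k` touches the `i`-th piece. If two pieces are touched, `k` alone is a
    -- trifurcation; if at most one is, `K` without `k` still trifurcates and the induction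
    -- continues.
    set T : Fin 3 → Prop := fun i => ∃ b, (H.avoid (K : Set V)).Reachable (a i) b ∧ H.Adj k b
      with hT
    have hle : H.avoid (K : Set V) ≤ H.avoid {k} := avoid_anti H (by simpa using hk)
    have hinfk : ∀ i b, (H.avoid (K : Set V)).Reachable (a i) b →
        ((H.avoid {k}).reachSet b).Infinite := fun i b hb =>
      (hinf i).mono fun x hx => hb.symm.trans hx |>.mono hle
    -- the two situations, up to the order of the three components
    have two : ∀ i j l, i ≠ j → i ≠ l → j ≠ l → T i → T j → H.IsTrifurcating {k} := by
      rintro i j l hij hil hjl ⟨b, hb, hkb⟩ ⟨b', hb', hkb'⟩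
      have hbb' : b ≠ b' := fun h => hsep i j hij (hb.trans (h ▸ hb'.symm))
      by_cases hl : T l
      · obtain ⟨b'', hb'', hkb''⟩ := hl
        exact hH.isTrifurcating_singleton hkb hkb' hkb'' hbb'
          (fun h => hsep i l hil (hb.trans (h ▸ hb''.symm)))
          (fun h => hsep j l hjl (hb'.trans (h ▸ hb''.symm)))
          (hinfk i b hb) (hinfk j b' hb') (hinfk l b'' hb'')
      -- The third infinite branch at `k` starts at `c`: it runs through the connected set `K.erase
      -- k` into the untouched piece of `a l`.
      · have hcK' := Finset.mem_erase.1 hcK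
        refine hH.isTrifurcating_singleton hkb hkb' hkc hbb'
          (fun h => (hb.notMem_of_avoid (haK i)) (h ▸ hcK'.2))
          (fun h => (hb'.notMem_of_avoid (haK j)) (h ▸ hcK'.2))
          (hinfk i b hb) (hinfk j b' hb') ?_
        obtain ⟨m, hm, hma⟩ := hadj l
        have hmk : m ≠ k := fun h => hl ⟨a l, .rfl, h ▸ hma⟩
        have hak : a l ≠ k := fun h => haK l (h ▸ hk)
        refine (hinfk l (a l) .rfl).mono fun x hx => ?_
        refine Reachable.trans ?_ hx
        refine ((herase c hcK m (Finset.mem_erase.2 ⟨hmk, hm⟩)).mono ?_).trans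
          (Adj.reachable (G := H.avoid {k}) ⟨hma, hmk, hak⟩)
        exact avoid_anti H (by simp)
    have atmost : ∀ i j l, i ≠ j → i ≠ l → j ≠ l → ¬ T i → ¬ T j →
        ∃ z ∈ K, H.IsTrifurcating {z} := by
      intro i j l hij hil hjl hi hj
      have hKn : (K.erase k).card = n := by rw [Finset.card_erase_of_mem hk]; omega
      have hclosed : ∀ m, ¬ T m → ∀ b ∈ (H.avoid (K : Set V)).reachSet (a m), ¬ H.Adj k b :=
        fun m hm b hb hkb => hm ⟨b, hb, hkb⟩
      have hadj' : ∀ m, ¬ T m → ∃ q ∈ ((K.erase k : Finset V) : Set V), H.Adj q (a m) := by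
        intro m hm
        obtain ⟨q, hq, hqa⟩ := hadj m
        exact ⟨q, Finset.mem_coe.2 (Finset.mem_erase.2
          ⟨fun h => hm ⟨a m, .rfl, h ▸ hqa⟩, hq⟩), hqa⟩
      have hinf' : ∀ m, ¬ T m →
          ((H.avoid ((K.erase k : Finset V) : Set V)).reachSet (a m)).Infinite := fun m hm => by
        rw [← reachSet_avoid_erase (hclosed m hm) (haK m)]
        exact hinf m
      -- the third component, possibly enlarged by `k`
      obtain ⟨x, hxadj, hxinf, hxsep⟩ : ∃ x,
          (∃ q ∈ ((K.erase k : Finset V) : Set V), H.Adj q x) ∧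
          ((H.avoid ((K.erase k : Finset V) : Set V)).reachSet x).Infinite ∧
          ∀ m, m ≠ l → ¬ (H.avoid (K : Set V)).Reachable (a m) x := by
        by_cases hl : T l
        · obtain ⟨b, hb, hkb⟩ := hl
          refine ⟨k, ⟨c, hcK, hkc.symm⟩, (hinf l).mono fun y hy => ?_, fun m _ h =>
            h.notMem_of_avoid (haK m) hk⟩
          have hle' : H.avoid (K : Set V) ≤ H.avoid ((K.erase k : Finset V) : Set V) :=
            avoid_anti H (by simp)
          refine (Adj.reachable (G := H.avoid _) ⟨hkb, by simp, fun h => ?_⟩).trans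
            ((hb.symm.trans hy).mono hle')
          exact hb.notMem_of_avoid (haK l) (Finset.mem_of_mem_erase h)
        · exact ⟨a l, hadj' l hl, hinf' l hl, fun m hm => hsep m l hm⟩
      have sep : ∀ m, m ≠ l → ¬ T m →
          ¬ (H.avoid ((K.erase k : Finset V) : Set V)).Reachable (a m) x := fun m hml hm h =>
        hxsep m hml ((avoid_reachable_erase (hclosed m hm) (haK m)).1 h)
      have sepij : ¬ (H.avoid ((K.erase k : Finset V) : Set V)).Reachable (a i) (a j) := fun h =>
        hsep i j hij ((avoid_reachable_erase (hclosed i hi) (haK i)).1 h)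
      have htri' : H.IsTrifurcating ((K.erase k : Finset V) : Set V) :=
        isTrifurcating_of_three (hadj' i hi) (hadj' j hj) hxadj (hinf' i hi) (hinf' j hj) hxinf
          sepij (sep i hil hi) (sep j hjl hj)
      obtain ⟨z, hz, hz'⟩ := ih (K.erase k) hKn herase htri'
      exact ⟨z, Finset.mem_of_mem_erase hz, hz'⟩
    by_cases h0 : T 0 <;> by_cases h1 : T 1 <;> by_cases h2 : T 2
    · exact ⟨k, hk, two 0 1 2 (by decide) (by decide) (by decide) h0 h1⟩
    · exact ⟨k, hk, two 0 1 2 (by decide) (by decide) (by decide) h0 h1⟩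
    · exact ⟨k, hk, two 0 2 1 (by decide) (by decide) (by decide) h0 h2⟩
    · exact atmost 1 2 0 (by decide) (by decide) (by decide) h1 h2
    · exact ⟨k, hk, two 1 2 0 (by decide) (by decide) (by decide) h1 h2⟩
    · exact atmost 0 2 1 (by decide) (by decide) (by decide) h0 h2
    · exact atmost 0 1 2 (by decide) (by decide) (by decide) h0 h1
    · exact atmost 0 1 2 (by decide) (by decide) (by decide) h0 h1

/-- A one-ended branch contains no trifurcation vertex. -/
theorem IsOneEndedFrom.not_isTrifurcating {H : SimpleGraph V} {u v t : V}
    (h : (H.avoid {u}).IsOneEndedFrom v) (ht : (H.avoid {u}).Reachable v t) :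
    ¬ H.IsTrifurcating {t} := by
  intro htri
  have htu : t ∉ ({u} : Set V) := ht.notMem_of_avoid (notMem_of_infinite_reachSet h.1)
  -- Two branches at `t` miss `u`, so they survive the deletion of `u` and contradict one-endedness
  -- at `t`.
  obtain ⟨c, d, hcd, hc, hd, hci, hdi, hcu, hdu⟩ := htri.exists_avoiding u
  have key : ∀ c, H.Adj t c → ((H.avoid {t}).reachSet c).Infinite → ¬ (H.avoid {t}).Reachable c u →
      (H.avoid {u}).Adj t c ∧ (((H.avoid {u}).avoid {t}).reachSet c).Infinite := by
    intro c hc hci hcu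
    have hcu' : c ∉ ({u} : Set V) := fun h => hcu (h ▸ .rfl)
    refine ⟨⟨hc, htu, hcu'⟩, hci.mono fun x hx => ?_⟩
    refine Reachable.transfer_of_forall hx fun p hp q hpq => ⟨⟨hpq.1, ?_, ?_⟩, hpq.2⟩
    · rintro rfl
      exact hcu hp
    · rintro rfl
      exact hcu (hp.trans hpq.reachable)
  obtain ⟨hc1, hc2⟩ := key c hc hci hcu
  obtain ⟨hd1, hd2⟩ := key d hd hdi hdu
  exact hcd (h.2 t ht c d hc1 hd1 hc2 hd2)

/-- A branch containing a trifurcation vertex is infinite. -/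
theorem IsTrifurcating.infinite_branch {H : SimpleGraph V} {u c t : V} (htri : H.IsTrifurcating {t})
    (ht : (H.avoid {u}).Reachable c t) (htu : t ≠ u) : ((H.avoid {u}).reachSet c).Infinite := by
  obtain ⟨w, -, -, hw, -, hwi, -, hwu, -⟩ := htri.exists_avoiding u
  refine hwi.mono fun x hx => ?_
  refine reachable_avoid_of_not_reachable hw ?_ ht htu hx
  rintro _ rfl
  exact hwu

/-- In a forest, a trifurcation-free infinite branch and a trifurcation vertex in the same component
yield a trifurcation vertex with an infinite trifurcation-free branch. -/
theorem IsAcyclic.exists_trifurcation_free_branch {H : SimpleGraph V} (hH : H.IsAcyclic) {z : V}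
    (hz : H.IsTrifurcating {z}) : ∀ (n : ℕ) (u v : V), H.Adj u v → H.Reachable u z →
      H.dist u z = n → ((H.avoid {u}).reachSet v).Infinite →
      (∀ t, (H.avoid {u}).Reachable v t → ¬ H.IsTrifurcating {t}) →
      ∃ z', {x | H.SendsMass x z'}.Infinite := by
  have step : ∀ u v, H.Adj u v → ((H.avoid {u}).reachSet v).Infinite →
      (∀ t, (H.avoid {u}).Reachable v t → ¬ H.IsTrifurcating {t}) → H.IsTrifurcating {u} →
      ∃ z', {x | H.SendsMass x z'}.Infinite := fun u v huv hinf hfree hu =>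
    ⟨u, hinf.mono fun x hx => ⟨hu, v, huv, hinf, hfree, hx⟩⟩
  intro n
  induction n with
  | zero =>
    intro u v huv hr hd hinf hfree
    have : u = z := (hr.dist_eq_zero_iff).1 hd
    exact step u v huv hinf hfree (this ▸ hz)
  | succ n ih =>
    intro u v huv hr hd hinf hfree
    by_cases hu : H.IsTrifurcating {u}
    · exact step u v huv hinf hfree hu
    have hne : z ≠ u := fun h => hu (h ▸ hz)
    obtain ⟨p, hp⟩ := hr.exists_walk_length_eq_dist
    cases p with
    | nil => exact absurd rfl hne
    | @cons _ q _ huq p =>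
      have hq : H.dist q z ≤ n := by
        have := dist_le p
        simp only [Walk.length_cons] at hp
        omega
      have hq' : H.dist q z = n := by
        have h1 : H.dist u z ≤ H.dist q z + 1 := by
          obtain ⟨p', hp'⟩ := p.reachable.exists_walk_length_eq_dist
          rw [← hp']
          exact dist_le (Walk.cons huq p')
        omega
      have hpath : (Walk.cons huq p).IsPath := Walk.isPath_of_length_eq_dist _ hp
      have hqz : (H.avoid {u}).Reachable q z :=
        p.reachable_avoid fun x hx hxu => (Walk.cons_isPath_iff _ _ |>.1 hpath).2 (hxu ▸ hx)
      have hvq : v ≠ q := fun h => hfree z (h ▸ hqz) hz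
      -- Step towards `z`: the branch at `q` through `u` contains the old infinite branch, and it is
      -- still trifurcation-free.
      refine ih q u huq.symm p.reachable hq' (hinf.mono fun x hx => ?_) fun t ht htri => ?_
      · have hvq' := hH.not_reachable_avoid huv huq hvq
        refine (Adj.reachable (G := H.avoid {q}) ⟨huv, huq.ne, hvq⟩).trans ?_
        refine Reachable.transfer_of_forall hx fun a ha b hab => ⟨hab.1, ?_, ?_⟩
        · rintro rfl
          exact hvq' ha
        · rintro rfl
          exact hvq' (ha.trans hab.reachable)
      · by_cases htu : t = u
        · exact hu (htu ▸ htri)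
        -- A trifurcation `t` in the enlarged branch lies beyond a neighbour `c` of `u` other than
        -- `v` and `q`. Then `c`, `q` and `v` start three infinite branches at `u`, which was
        -- assumed not to be a trifurcation.
        obtain ⟨c, huc, hct⟩ := ht.exists_adj_avoid htu
        have hcq : c ≠ q := huc.2.2
        have hct' : (H.avoid {u}).Reachable c t := hct.mono (by
          rw [avoid_avoid]
          exact avoid_anti H (by simp))
        have hcv : c ≠ v := fun h => hfree t (h ▸ hct') htri
        exact hu (hH.isTrifurcating_singleton huc.1 huq huv hcq hcv hvq.symm
          (htri.infinite_branch hct' htu) (hz.infinite_branch hqz hne) hinf)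

/-- In a forest, a component with a trifurcation and an isolated end has a vertex receiving
infinite mass. -/
theorem IsAcyclic.exists_infinite_sendsMass {H : SimpleGraph V} (hH : H.IsAcyclic) {x y : V}
    (hx : H.HasIsolatedEnd x) (hy : H.HasTrifurcation y) (hxy : H.Reachable x y) :
    ∃ z, {x | H.SendsMass x z}.Infinite := by
  obtain ⟨u, v, huv, hxu, -, hone⟩ := hx
  obtain ⟨K, hyK, hconn, htri⟩ := hy
  obtain ⟨z, hzK, hz⟩ := hH.exists_isTrifurcating_singleton _ K rfl hconn htri
  exact hH.exists_trifurcation_free_branch hz _ u v huv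
    ((hxu.symm.trans hxy).trans ((hconn y hyK z hzK).mono (avoid_le _ _))) rfl hone.1
    fun t ht => hone.not_isTrifurcating ht

/-- If `z ≠ z'`, the trifurcation-free branch at `z` containing `x` misses `z'`. Hence `x` is joined
to `z` without meeting `z'`, which puts the trifurcation `z` in the trifurcation-free branch at
`z'`. This bounds the outgoing mass by one. -/
theorem SendsMass.unique {H : SimpleGraph V} {x z z' : V} (h : H.SendsMass x z)
    (h' : H.SendsMass x z') : z = z' := by
  by_contra hne
  obtain ⟨hz, w, hzw, -, hfree, hx⟩ := h
  obtain ⟨hz', w', hzw', -, hfree', hx'⟩ := h'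
  have h1 : (H.avoid {z'}).Reachable w x :=
    hx.transfer_of_forall fun a ha b hab => ⟨hab.1, fun h => hfree z' (h ▸ ha) hz',
      fun h => hfree z' (h ▸ ha.trans hab.reachable) hz'⟩
  have hw : w ≠ z' := fun h => hfree w .rfl (h ▸ hz')
  exact hfree' z ((hx'.trans h1.symm).trans
    (Adj.reachable (G := H.avoid {z'}) ⟨hzw.symm, hw, hne⟩)) hz

/-! ### Transfer between a graph and its components, and under automorphisms -/

/-- `ι` identifies `T` with a union of connected components of `H`. -/
structure IsComponentEmbedding (T : SimpleGraph W) (H : SimpleGraph V) (ι : W → V) : Prop where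
  injective : Function.Injective ι
  adj_iff : ∀ a b, H.Adj (ι a) (ι b) ↔ T.Adj a b
  closed : ∀ a b, H.Adj (ι a) b → b ∈ Set.range ι

namespace IsComponentEmbedding

variable {T : SimpleGraph W} {H : SimpleGraph V} {ι : W → V}

theorem avoid (h : IsComponentEmbedding T H ι) (K : Set W) :
    IsComponentEmbedding (T.avoid K) (H.avoid (ι '' K)) ι where
  injective := h.injective
  adj_iff a b := by
    simp only [avoid_adj, h.adj_iff, h.injective.mem_set_image]
  closed a b hab := h.closed a b hab.1

theorem avoid_singleton (h : IsComponentEmbedding T H ι) (z : W) :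
    IsComponentEmbedding (T.avoid {z}) (H.avoid {ι z}) ι := by
  simpa using h.avoid {z}

theorem reachable_map (h : IsComponentEmbedding T H ι) {a b : W} (hab : T.Reachable a b) :
    H.Reachable (ι a) (ι b) :=
  hab.map (⟨ι, fun {a b} => (h.adj_iff a b).2⟩ : T →g H)

theorem exists_of_reachable (h : IsComponentEmbedding T H ι) {a : W} {b : V}
    (hab : H.Reachable (ι a) b) : ∃ c, ι c = b ∧ T.Reachable a c := by
  refine hab.induction_on (p := fun b => ∃ c, ι c = b ∧ T.Reachable a c) ⟨a, rfl, .rfl⟩ ?_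
  rintro _ d - hcd ⟨c, rfl, hc⟩
  obtain ⟨d, rfl⟩ := h.closed _ _ hcd
  exact ⟨d, rfl, hc.trans ((h.adj_iff c d).1 hcd).reachable⟩

theorem reachable_iff (h : IsComponentEmbedding T H ι) {a b : W} :
    H.Reachable (ι a) (ι b) ↔ T.Reachable a b := by
  refine ⟨fun hab => ?_, h.reachable_map⟩
  obtain ⟨c, hc, hac⟩ := h.exists_of_reachable hab
  exact h.injective hc ▸ hac

theorem image_reachSet (h : IsComponentEmbedding T H ι) (a : W) :
    H.reachSet (ι a) = ι '' T.reachSet a := by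
  ext b
  constructor
  · intro hb
    obtain ⟨c, rfl, hc⟩ := h.exists_of_reachable hb
    exact ⟨c, hc, rfl⟩
  · rintro ⟨c, hc, rfl⟩
    exact h.reachable_map hc

theorem infinite_iff (h : IsComponentEmbedding T H ι) {a : W} :
    (H.reachSet (ι a)).Infinite ↔ (T.reachSet a).Infinite := by
  rw [h.image_reachSet, Set.infinite_image_iff h.injective.injOn]

theorem isTrifurcating_iff (h : IsComponentEmbedding T H ι) {K : Set W} :
    H.IsTrifurcating (ι '' K) ↔ T.IsTrifurcating K := by
  have hK := h.avoid K
  constructor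
  · rintro ⟨a, hadj, hinf, hsep⟩
    have : ∀ i, ∃ c, ι c = a i := fun i => by
      obtain ⟨_, ⟨k, -, rfl⟩, hk⟩ := hadj i
      exact h.closed _ _ hk
    choose c hc using this
    obtain rfl : (fun i => ι (c i)) = a := funext hc
    refine ⟨c, fun i => ?_, fun i => hK.infinite_iff.1 (hinf i),
      fun i j hij hr => hsep i j hij (hK.reachable_map hr)⟩
    obtain ⟨_, ⟨k, hkK, rfl⟩, hk⟩ := hadj i
    exact ⟨k, hkK, (h.adj_iff _ _).1 hk⟩
  · rintro ⟨a, hadj, hinf, hsep⟩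
    refine ⟨fun i => ι (a i), fun i => ?_, fun i => hK.infinite_iff.2 (hinf i),
      fun i j hij hr => hsep i j hij (hK.reachable_iff.1 hr)⟩
    obtain ⟨k, hkK, hk⟩ := hadj i
    exact ⟨ι k, ⟨k, hkK, rfl⟩, (h.adj_iff _ _).2 hk⟩

theorem isTrifurcating_singleton_iff (h : IsComponentEmbedding T H ι) {z : W} :
    H.IsTrifurcating {ι z} ↔ T.IsTrifurcating {z} := by
  rw [← h.isTrifurcating_iff, Set.image_singleton]

theorem hasTrifurcation (h : IsComponentEmbedding T H ι) {y : W} (hy : T.HasTrifurcation y) :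
    H.HasTrifurcation (ι y) := by
  classical
  obtain ⟨K, hyK, hconn, htri⟩ := hy
  refine ⟨K.image ι, Finset.mem_image_of_mem _ hyK, fun a ha b hb => ?_, ?_⟩
  · obtain ⟨p, hp, rfl⟩ := Finset.mem_image.1 ha
    obtain ⟨q, hq, rfl⟩ := Finset.mem_image.1 hb
    refine (hconn p hp q hq).map (⟨ι, fun {p q} hpq => ⟨(h.adj_iff p q).2 hpq.1, ?_, ?_⟩⟩ :
      T.avoid (K : Set W)ᶜ →g H.avoid ((K.image ι : Finset V) : Set V)ᶜ)
    · exact fun hp => hp (Finset.mem_coe.2 (Finset.mem_image_of_mem _ (not_not.1 hpq.2.1)))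
    · exact fun hq => hq (Finset.mem_coe.2 (Finset.mem_image_of_mem _ (not_not.1 hpq.2.2)))
  · rw [Finset.coe_image]
    exact h.isTrifurcating_iff.2 htri

theorem isOneEndedFrom (h : IsComponentEmbedding T H ι) {v : W} (hv : T.IsOneEndedFrom v) :
    H.IsOneEndedFrom (ι v) := by
  refine ⟨h.infinite_iff.2 hv.1, fun a ha c d hac had hc hd => ?_⟩
  obtain ⟨a, rfl, ha'⟩ := h.exists_of_reachable ha
  obtain ⟨c, rfl⟩ := h.closed _ _ hac
  obtain ⟨d, rfl⟩ := h.closed _ _ had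
  have hA := h.avoid_singleton a
  exact congrArg ι (hv.2 a ha' c d ((h.adj_iff _ _).1 hac) ((h.adj_iff _ _).1 had)
    (hA.infinite_iff.1 hc) (hA.infinite_iff.1 hd))

theorem hasIsolatedEnd (h : IsComponentEmbedding T H ι) {x : W} (hx : T.HasIsolatedEnd x) :
    H.HasIsolatedEnd (ι x) := by
  obtain ⟨u, v, huv, hxu, hvx, hone⟩ := hx
  exact ⟨ι u, ι v, (h.adj_iff _ _).2 huv, h.reachable_map hxu,
    fun hr => hvx ((h.avoid_singleton u).reachable_iff.1 hr),
    (h.avoid_singleton u).isOneEndedFrom hone⟩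

theorem sendsMass (h : IsComponentEmbedding T H ι) {x z : W} (hx : T.SendsMass x z) :
    H.SendsMass (ι x) (ι z) := by
  obtain ⟨hz, w, hzw, hinf, hfree, hwx⟩ := hx
  have hA := h.avoid_singleton z
  refine ⟨h.isTrifurcating_singleton_iff.2 hz, ι w, (h.adj_iff _ _).2 hzw, hA.infinite_iff.2 hinf,
    fun t ht htri => ?_, hA.reachable_map hwx⟩
  obtain ⟨t, rfl, ht'⟩ := hA.exists_of_reachable ht
  exact hfree t ht' (h.isTrifurcating_singleton_iff.1 htri)

end IsComponentEmbedding

theorem ConnectedComponent.isComponentEmbedding {H : SimpleGraph V} (C : H.ConnectedComponent) :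
    IsComponentEmbedding C.toSimpleGraph H (Subtype.val : C → V) where
  injective := Subtype.val_injective
  adj_iff _ _ := Iff.rfl
  closed a b hab := ⟨⟨b, C.mem_supp_of_adj_mem_supp a.2 hab⟩, rfl⟩

/-! ### Ends as coherent families of complementary components -/

section Ends

open CategoryTheory Opposite

variable {T : SimpleGraph W}

theorem reachable_induce_compl_iff {K : Set W} {a b : W} (ha : a ∉ K) (hb : b ∉ K) :
    (T.induce Kᶜ).Reachable ⟨a, ha⟩ ⟨b, hb⟩ ↔ (T.avoid K).Reachable a b := by
  constructor
  · intro h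
    exact h.map (⟨Subtype.val, fun {p q} hpq => ⟨hpq, p.2, q.2⟩⟩ : T.induce Kᶜ →g T.avoid K)
  · intro h
    suffices ∃ hb : b ∉ K, (T.induce Kᶜ).Reachable ⟨a, ha⟩ ⟨b, hb⟩ from this.2
    refine h.induction_on
      (p := fun b => ∃ hb : b ∉ K, (T.induce Kᶜ).Reachable ⟨a, ha⟩ ⟨b, hb⟩) ⟨ha, .rfl⟩ ?_
    rintro c d - hcd ⟨hc, hac⟩
    exact ⟨hcd.2.2, hac.trans
      (Adj.reachable (G := T.induce Kᶜ) (u := ⟨c, hc⟩) (v := ⟨d, hcd.2.2⟩) hcd.1)⟩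

theorem ComponentCompl.mem_iff_reachable {K : Set W} (C : T.ComponentCompl K) {v w : W}
    (hv : v ∈ C.supp) : w ∈ C.supp ↔ (T.avoid K).Reachable v w := by
  obtain ⟨hvK, rfl⟩ := hv
  constructor
  · rintro ⟨hwK, h⟩
    exact (reachable_induce_compl_iff hvK hwK).1 (ConnectedComponent.exact h.symm)
  · intro h
    have hwK := h.notMem_of_avoid hvK
    exact ⟨hwK, ConnectedComponent.sound ((reachable_induce_compl_iff hvK hwK).2 h).symm⟩

theorem ComponentCompl.supp_eq_reachSet {K : Set W} (C : T.ComponentCompl K) {v : W}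
    (hv : v ∈ C.supp) : C.supp = (T.avoid K).reachSet v :=
  Set.ext fun _ => C.mem_iff_reachable hv

theorem end_supp_subset {s} (hs : s ∈ T.end) {K L : Finset W} (h : K ⊆ L) :
    ComponentCompl.supp (s (op L)) ⊆ ComponentCompl.supp (s (op K)) := by
  have h1 : ComponentCompl.hom (Finset.coe_subset.2 h) (s (op L)) = s (op K) :=
    hs (opHomOfLE h : op L ⟶ op K)
  rw [← h1]
  exact ComponentCompl.subset_hom _ _

theorem end_supp_infinite {s} (hs : s ∈ T.end) (K : Finset W) :
    (ComponentCompl.supp (s (op K))).Infinite :=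
  (ComponentCompl.infinite_iff_in_all_ranges _).2 fun L h =>
    ⟨s (op L), hs (opHomOfLE h : op L ⟶ op K)⟩

/-- The component that the end selects for `K ∪ L` lies in both selected components. -/
theorem end_exists_reachable {s} (hs : s ∈ T.end) {K L : Finset W} {v w : W}
    (hv : v ∈ ComponentCompl.supp (s (op K))) (hw : w ∈ ComponentCompl.supp (s (op L))) :
    ∃ b, (T.avoid K).Reachable v b ∧ (T.avoid L).Reachable w b := by
  classical
  obtain ⟨b, hb⟩ := ComponentCompl.nonempty (s (op (K ∪ L)))
  exact ⟨b, (ComponentCompl.mem_iff_reachable _ hv).1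
      (end_supp_subset hs Finset.subset_union_left hb),
    (ComponentCompl.mem_iff_reachable _ hw).1 (end_supp_subset hs Finset.subset_union_right hb)⟩

theorem end_mem_of_subset {s} (hs : s ∈ T.end) {K L : Finset W} {v w : W}
    (hw : w ∈ ComponentCompl.supp (s (op L)))
    (h : (T.avoid L).reachSet w ⊆ (T.avoid K).reachSet v) :
    v ∈ ComponentCompl.supp (s (op K)) := by
  obtain ⟨v', hv'⟩ := ComponentCompl.nonempty (s (op K))
  obtain ⟨b, hb, hb'⟩ := end_exists_reachable hs hv' hw
  exact (ComponentCompl.mem_iff_reachable _ hv').2 (hb.trans (h hb').symm)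

/-- By local finiteness the complementary components form an inverse system of finite sets, which is
Mittag-Leffler. An infinite component lies in the eventual range, where the transition maps are
surjective, so it extends to a section. -/
theorem exists_end_of_infinite [T.LocallyFinite] (hT : T.Connected) {K : Finset W} {v : W}
    (hinf : ((T.avoid K).reachSet v).Infinite) :
    ∃ s ∈ T.end, v ∈ ComponentCompl.supp (s (op K)) := by
  have : Fact T.Preconnected := ⟨hT.preconnected⟩
  have hfin : ∀ j, Finite (T.componentComplFunctor.obj j) := fun j =>
    T.componentCompl_finite j.unop
  have hinfW : Infinite W := Set.infinite_univ_iff.1 (hinf.mono (Set.subset_univ _))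
  have hne : ∀ j, Nonempty (T.componentComplFunctor.obj j) := fun j =>
    T.componentCompl_nonempty_of_infinite j.unop
  have hML : T.componentComplFunctor.IsMittagLeffler :=
    Functor.isMittagLeffler_of_exists_finite_range _ fun j => ⟨j, 𝟙 j, Set.toFinite _⟩
  have hne' : ∀ j, Nonempty (T.componentComplFunctor.toEventualRanges.obj j) :=
    Functor.toEventualRanges_nonempty _ hML
  have hvK : v ∉ (K : Set W) := notMem_of_infinite_reachSet hinf
  have hmem : v ∈ (T.componentComplMk hvK).supp := T.componentComplMk_mem hvK
  have hC : (T.componentComplMk hvK).supp.Infinite := by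
    rw [ComponentCompl.supp_eq_reachSet _ hmem]
    exact hinf
  have hC' := (T.infinite_iff_in_eventualRange (K := op K) (T.componentComplMk hvK)).1 hC
  obtain ⟨s, hs⟩ := Functor.eval_section_surjective_of_surjective
    T.componentComplFunctor.toEventualRanges
    (Functor.surjective_toEventualRanges _ hML) (op K) ⟨T.componentComplMk hvK, hC'⟩
  refine ⟨_, (T.componentComplFunctor.toEventualRangesSectionsEquiv s).2, ?_⟩
  have : (T.componentComplFunctor.toEventualRangesSectionsEquiv s).1 (op K) =
      T.componentComplMk hvK := congrArg Subtype.val hs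
  rw [this]
  exact hmem

/-- A connected graph with infinitely many ends has a trifurcating set around each vertex. -/
theorem hasTrifurcation_of_end_infinite (hT : T.Connected) (h : T.end.Infinite) (y : W) :
    T.HasTrifurcation y := by
  classical
  let e : Fin 3 → T.end := fun i => h.natEmbedding _ i
  have he : Function.Injective e := fun i j hij =>
    Fin.ext ((h.natEmbedding _).injective hij)
  -- Two distinct ends differ at some finite set; on the diagonal `∅` is a dummy value. One
  -- connected `L` containing all these sets and `y` separates the three ends at once.
  have hsep : ∀ i j, ∃ K : (Finset W)ᵒᵖ, i ≠ j → (e i).1 K ≠ (e j).1 K := by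
    intro i j
    by_cases hij : i = j
    · exact ⟨op ∅, fun h => absurd hij h⟩
    · obtain ⟨K, hK⟩ := Function.ne_iff.1 (fun h' => hij (he (Subtype.ext h')) :
        (e i).1 ≠ (e j).1)
      exact ⟨K, fun _ => hK⟩
  choose K hK using hsep
  obtain ⟨L, hL, hconn⟩ := extend_finset_to_connected hT.preconnected
    (t := insert y (Finset.univ.biUnion fun i => Finset.univ.biUnion fun j => (K i j).unop))
    (Finset.insert_nonempty _ _)
  have hyL : y ∈ L := hL (Finset.mem_insert_self _ _)
  have hKL : ∀ i j, (K i j).unop ⊆ L := fun i j k hk => hL (Finset.mem_insert_of_mem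
    (Finset.mem_biUnion.2 ⟨i, Finset.mem_univ _, Finset.mem_biUnion.2 ⟨j, Finset.mem_univ _, hk⟩⟩))
  have hb : ∀ i, ∃ ck : W × W, ck.1 ∈ ComponentCompl.supp ((e i).1 (op L)) ∧ ck.2 ∈ L ∧
      T.Adj ck.1 ck.2 := fun i =>
    ComponentCompl.exists_adj_boundary_pair hT.preconnected ⟨y, Finset.mem_coe.2 hyL⟩
      ((e i).1 (op L))
  choose ck hck hckL hadj using hb
  refine ⟨L, hyL, fun a ha b hb => reachable_avoid_compl_of_induce hconn.preconnected ha hb,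
    fun i => (ck i).1, fun i => ⟨_, hckL i, (hadj i).symm⟩, fun i => ?_, fun i j hij hr => ?_⟩
  · rw [← ComponentCompl.supp_eq_reachSet _ (hck i)]
    exact end_supp_infinite (e i).2 L
  · have h1 := (ComponentCompl.mem_iff_reachable _ (hck i)).2 hr
    have h2 : (e i).1 (op L) = (e j).1 (op L) := by
      obtain ⟨p, hp⟩ := h1
      obtain ⟨q, hq⟩ := hck j
      exact hp.symm.trans hq
    refine hK i j hij ?_
    have hh : ∀ i', ComponentCompl.hom (Finset.coe_subset.2 (hKL i j)) ((e i').1 (op L)) =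
        (e i').1 (K i j) := fun i' => (e i').2 (opHomOfLE (hKL i j) : op L ⟶ op (K i j).unop)
    rw [← hh i, ← hh j, h2]

/-- In an infinite locally finite tree, each vertex has an infinite branch. -/
theorem exists_infinite_branch [T.LocallyFinite] {x : W} (hinf : (T.reachSet x).Infinite) :
    ∃ w, T.Adj x w ∧ ((T.avoid {x}).reachSet w).Infinite := by
  by_contra! hcon
  refine hinf (((Set.finite_singleton x).union (Set.Finite.biUnion
    (Set.toFinite (T.neighborSet x)) (t := fun w => (T.avoid {x}).reachSet w)
    fun w hw => hcon w hw)).subset fun t ht => ?_)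
  by_cases htx : t = x
  · exact Or.inl htx
  · obtain ⟨c, hc, hct⟩ := Reachable.exists_adj_avoid ht htx
    exact Or.inr (Set.mem_biUnion hc hct)

/-- An infinite locally finite tree without infinitely many ends has an isolated end. -/
theorem hasIsolatedEnd_of_end_finite [T.LocallyFinite] [Infinite W] (hT : T.IsTree)
    (hfin : T.end.Finite) (x : W) : T.HasIsolatedEnd x := by
  classical
  have hac := hT.isAcyclic
  have hcon := hT.connected
  -- `D` consists of the oriented edges whose branch is infinite and points away from `x`, and `E d`
  -- is the set of ends in the branch of `d`. An element of `D` with the fewest ends is shown to be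
  -- one-ended.
  let E : W × W → Set (∀ j, T.componentComplFunctor.obj j) := fun d =>
    {s | s ∈ T.end ∧ d.2 ∈ ComponentCompl.supp (s (op {d.1}))}
  let D : Set (W × W) := {d | T.Adj d.1 d.2 ∧ ¬ (T.avoid {d.1}).Reachable d.2 x ∧
    ((T.avoid {d.1}).reachSet d.2).Infinite}
  have hEfin : ∀ d, (E d).Finite := fun d => hfin.subset fun s hs => hs.1
  have hDne : D.Nonempty := by
    have : (T.reachSet x).Infinite := by
      rw [show T.reachSet x = Set.univ from Set.eq_univ_of_forall fun y => hcon.preconnected x y]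
      exact Set.infinite_univ
    obtain ⟨w, hw, hwi⟩ := exists_infinite_branch this
    exact ⟨(x, w), hw, fun h => h.notMem_of_avoid (notMem_of_infinite_reachSet hwi) rfl, hwi⟩
  obtain ⟨⟨u, v⟩, ⟨huv, hvx, hvinf⟩, hmin⟩ :=
    WellFounded.has_min (measure fun d : W × W => (E d).ncard).wf D hDne
  simp only at huv hvx hvinf
  refine ⟨u, v, huv, hcon.preconnected x u, hvx, hvinf, fun a ha c d hac' had hc hd => ?_⟩
  by_contra hcd
  -- Two infinite branches at `a` cannot both lead back to `v` without closing a cycle. One that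
  -- does not lead back would be a member of `D` with strictly fewer ends.
  suffices key : ∀ c d, c ≠ d → (T.avoid {u}).Adj a c → (T.avoid {u}).Adj a d →
      (((T.avoid {u}).avoid {a}).reachSet c).Infinite →
      (((T.avoid {u}).avoid {a}).reachSet d).Infinite →
      ((T.avoid {u}).avoid {a}).Reachable d v by
    have h1 := key c d hcd hac' had hc hd
    have h2 := key d c (Ne.symm hcd) had hac' hd hc
    exact (hac.avoid {u}).not_reachable_avoid hac' had hcd (h2.trans h1.symm)
  intro c d hcd hac' had hc hd
  by_contra hdv
  -- A route from `u` to `d` avoiding `a` must leave `u` through `v`, by acyclicity; it would then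
  -- lead `d` back to `v`.
  have hdu : ¬ (T.avoid {a}).Reachable d u := by
    intro h
    have hud : d ≠ u := had.2.2
    obtain ⟨c', hc', hc'd⟩ := h.symm.exists_adj_avoid hud
    have hc'v : c' = v := by
      by_contra hne
      refine hac.not_reachable_avoid hc'.1 huv hne ?_
      refine (hc'd.mono ?_).trans ((had.reachable.symm).trans ha.symm)
      rw [avoid_avoid]
      exact avoid_anti T (by simp)
    subst hc'v
    refine hdv (hc'd.symm.mono ?_)
    rw [avoid_avoid, avoid_avoid, Set.union_comm]
  have hsub : (T.avoid {a}).reachSet d ⊆ ((T.avoid {u}).avoid {a}).reachSet d := fun b hb =>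
    Reachable.transfer_of_forall hb fun p hp q hpq => ⟨⟨hpq.1, fun h => hdu (h ▸ hp),
      fun h => hdu (h ▸ hp.trans hpq.reachable)⟩, hpq.2⟩
  have hle : (T.avoid {u}).avoid {a} ≤ T.avoid {a} := by
    rw [avoid_avoid]
    exact avoid_anti T (by simp)
  have hsub' : (T.avoid {a}).reachSet d ⊆ (T.avoid {u}).reachSet v := fun b hb =>
    ha.trans (had.reachable.trans ((hsub hb).mono (avoid_le _ _)))
  have hD : (a, d) ∈ D := ⟨had.1, fun h => hvx (hsub' h), hd.mono fun b hb => hb.mono hle⟩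
  refine hmin (a, d) hD (Set.ncard_lt_ncard ?_ (hEfin _))
  refine (Set.ssubset_iff_of_subset fun s hs => ?_).2 ?_
  · refine ⟨hs.1, end_mem_of_subset hs.1 hs.2 ?_⟩
    simpa using hsub'
  -- Strictness: an end running through `c` beyond both `u` and `a` belongs to the branch of `(u,
  -- v)` but not to that of `(a, d)`.
  · have hset : (T.avoid {u}).avoid {a} = T.avoid (({u, a} : Finset W) : Set W) := by
      rw [avoid_avoid]
      congr 1
      ext
      simp [or_comm]
    rw [hset] at hc
    obtain ⟨s, hs, hcs⟩ := exists_end_of_infinite hcon hc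
    refine ⟨s, ⟨hs, end_mem_of_subset hs hcs fun b hb => ?_⟩, fun hsd => ?_⟩
    · rw [← hset] at hb
      have : (T.avoid {u}).Reachable v b :=
        ha.trans (hac'.reachable.trans (Reachable.mono (avoid_le _ _) hb))
      simpa [mem_reachSet] using this
    · obtain ⟨b, hb1, hb2⟩ := end_exists_reachable hs hsd.2 hcs
      rw [← hset] at hb2
      refine hac.not_reachable_avoid hac'.1 had.1 hcd ((hb2.mono hle).trans ?_)
      simpa using hb1.symm

end Ends

theorem ConnectedComponent.hasTrifurcation {H : SimpleGraph V} (C : H.ConnectedComponent) {x : V}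
    (hx : x ∈ C.supp) (h : C.toSimpleGraph.end.Infinite) : H.HasTrifurcation x :=
  C.isComponentEmbedding.hasTrifurcation (y := ⟨x, hx⟩)
    (hasTrifurcation_of_end_infinite C.connected_toSimpleGraph h _)

theorem IsAcyclic.hasIsolatedEnd {H : SimpleGraph V} (hH : H.IsAcyclic)
    (hfin : ∀ v, (H.neighborSet v).Finite) (C : H.ConnectedComponent) {x : V} (hx : x ∈ C.supp)
    (hinf : C.supp.Infinite) (h : ¬ C.toSimpleGraph.end.Infinite) : H.HasIsolatedEnd x := by
  have : Infinite C := hinf.to_subtype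
  have : C.toSimpleGraph.LocallyFinite := fun v =>
    Set.Finite.fintype (Set.Finite.of_injOn (f := Subtype.val) (t := H.neighborSet v)
      (fun w hw => hw) Subtype.val_injective.injOn (hfin v))
  exact C.isComponentEmbedding.hasIsolatedEnd (x := ⟨x, hx⟩)
    (hasIsolatedEnd_of_end_finite (hH.isTree_connectedComponent C) (Set.not_infinite.1 h) _)

/-! ### Stability of the two features under edge surgery -/

section Modification

variable {H H' : SimpleGraph V}

/-- Isolated ends survive a modification that, within the component of `x`, only adds edges
at `x`. -/
theorem HasIsolatedEnd.congr {x : V} (h : H.HasIsolatedEnd x)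
    (hle : ∀ b, H.Reachable x b → ∀ c, H.Adj b c → H'.Adj b c)
    (hge : ∀ b, H.Reachable x b → b ≠ x → ∀ c, H'.Adj b c → H.Adj b c) :
    H'.HasIsolatedEnd x := by
  obtain ⟨u, v, huv, hxu, hvx, hone⟩ := h
  have hb : ∀ b ∈ (H.avoid {u}).reachSet v, ∀ c,
      (H.avoid {u}).Adj b c ↔ (H'.avoid {u}).Adj b c := by
    intro b hb c
    have hxb : H.Reachable x b := hxu.trans (huv.reachable.trans (hb.mono (avoid_le _ _)))
    have hbx : b ≠ x := fun h => hvx (h ▸ hb)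
    exact and_congr_left' ⟨hle b hxb c, hge b hxb hbx c⟩
  refine ⟨u, v, hle u hxu v huv, hxu.transfer_of_forall hle, fun h => hvx ?_,
    isOneEndedFrom_of_congr hb hone⟩
  exact (Set.ext_iff.1 (reachSet_congr hb) x).2 h

theorem HasIsolatedEnd.infinite {x : V} (h : H.HasIsolatedEnd x) : (H.reachSet x).Infinite := by
  obtain ⟨u, v, huv, hxu, -, hone⟩ := h
  exact hone.1.mono fun b hb => hxu.trans (huv.reachable.trans (hb.mono (avoid_le _ _)))

theorem HasTrifurcation.infinite {y : V} (h : H.HasTrifurcation y) : (H.reachSet y).Infinite := by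
  obtain ⟨K, hyK, hconn, a, hadj, hinf, -⟩ := h
  obtain ⟨k, hk, hka⟩ := hadj 0
  exact (hinf 0).mono fun b hb => ((hconn y hyK k hk).mono (avoid_le _ _)).trans
    (hka.reachable.trans (hb.mono (avoid_le _ _)))

/-- Attaching a finite component to a component with a trifurcation. -/
theorem HasTrifurcation.attach_finite {y q : V} (h : H.HasTrifurcation y) (hyq : y ≠ q)
    (hfin : (H.reachSet q).Finite)
    (hH' : ∀ a b, H'.Adj a b ↔ H.Adj a b ∨ s(a, b) = s(q, y)) : H'.HasTrifurcation q := by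
  classical
  obtain ⟨K, hyK, hconn, a, hadj, hinf, hsep⟩ := h
  have hle : H ≤ H' := fun a b hab => (hH' a b).2 (Or.inl hab)
  have hKle : H.avoid (K : Set V)ᶜ ≤ H'.avoid ((insert q K : Finset V) : Set V)ᶜ := fun b c hbc =>
    ⟨hle hbc.1, fun h => hbc.2.1 fun h' => h (Finset.mem_coe.2 (Finset.mem_insert_of_mem h')),
      fun h => hbc.2.2 fun h' => h (Finset.mem_coe.2 (Finset.mem_insert_of_mem h'))⟩
  have hqy : (H'.avoid ((insert q K : Finset V) : Set V)ᶜ).Adj q y :=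
    ⟨(hH' q y).2 (Or.inr rfl), fun h => h (by simp), fun h => h (by simp [hyK])⟩
  have hto : ∀ b ∈ insert q K,
      (H'.avoid ((insert q K : Finset V) : Set V)ᶜ).Reachable b y := by
    intro b hb
    rcases Finset.mem_insert.1 hb with rfl | hb
    · exact hqy.reachable
    · exact (hconn b hb y hyK).mono hKle
  have hset : ∀ i, (H.avoid (K : Set V)).reachSet (a i) =
      (H'.avoid ((insert q K : Finset V) : Set V)).reachSet (a i) := by
    intro i
    -- The infinite pieces cannot meet the finite component of `q`, so the new edge does not touch
    -- them.
    have hq : ∀ b, (H.avoid (K : Set V)).Reachable (a i) b → b ≠ q := by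
      rintro b hb rfl
      exact hinf i (hfin.subset fun c hc => (hb.symm.trans hc).mono (avoid_le _ _))
    refine reachSet_congr fun b hb c => ?_
    have hbK : b ∉ (K : Set V) := Reachable.notMem_of_avoid hb (notMem_of_infinite_reachSet (hinf i))
    have hby : b ≠ y := fun h => hbK (h ▸ hyK)
    have hbq := hq b hb
    constructor
    · intro hbc
      have hcq := hq c (hb.trans hbc.reachable)
      refine ⟨hle hbc.1, ?_, ?_⟩
      · simpa [hbq] using hbK
      · simpa [hcq] using hbc.2.2
    · rintro ⟨h1, -, h3⟩
      rw [hH'] at h1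
      refine ⟨h1.resolve_right fun h => ?_, hbK, fun h => h3 (by simpa using Or.inr h)⟩
      rcases Sym2.eq_iff.1 h with h | h
      · exact hbq h.1
      · exact hby h.1
  refine ⟨insert q K, Finset.mem_insert_self _ _, fun b hb c hc => (hto b hb).trans (hto c hc).symm,
    a, fun i => ?_, fun i => hset i ▸ hinf i, fun i j hij h => hsep i j hij ?_⟩
  · obtain ⟨k, hk, hka⟩ := hadj i
    exact ⟨k, by simpa using Or.inr hk, hle hka⟩
  · exact (Set.ext_iff.1 (hset i) (a j)).2 h

/-- Joining an infinite component to a component with a trifurcating set `K`, and deleting at most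
one edge of the latter outside `K`, again yields a trifurcating set. -/
theorem IsTrifurcating.attach_infinite {x y : V} {K : Finset V} {R : Set (Sym2 V)} (hyK : y ∈ K)
    (hconn : ∀ a ∈ K, ∀ b ∈ K, (H.avoid (K : Set V)ᶜ).Reachable a b)
    (h : H.IsTrifurcating K) (hxy : ¬ H.Reachable x y) (hinfx : (H.reachSet x).Infinite)
    (hR : R.Subsingleton) (hRH : ∀ g ∈ R, g ∈ H.edgeSet)
    (hRy : ∀ g ∈ R, ∀ v ∈ g, H.Reachable y v ∧ v ∉ K)
    (hH' : ∀ a b, H'.Adj a b ↔ (H.Adj a b ∨ s(a, b) = s(x, y)) ∧ s(a, b) ∉ R) :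
    H'.HasTrifurcation y := by
  obtain ⟨a, hadj, hinf, hsep⟩ := h
  have hKR : ∀ k ∈ K, ∀ b, s(k, b) ∉ R := fun k hk b hkR => (hRy _ hkR k (by simp)).2 hk
  have hxR : ∀ b, H.Reachable x b → ∀ c, s(b, c) ∉ R := fun b hb c hbR =>
    hxy (hb.trans (hRy _ hbR b (by simp)).1.symm)
  have hyk : ∀ k ∈ K, H.Reachable y k := fun k hk => (hconn y hyK k hk).mono (avoid_le _ _)
  have hya : ∀ i, H.Reachable y (a i) := fun i => by
    obtain ⟨k, hk, hka⟩ := hadj i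
    exact (hyk k hk).trans hka.reachable
  -- The deleted edge has both endpoints outside `K`, hence meets at most one of the three pieces.
  -- The two others survive, and the component of `x` becomes the third.
  obtain ⟨i, j, hij, hi, hj⟩ := exists_pair_not_of_pairwise
    (p := fun i => ∃ g ∈ R, ∃ v ∈ g, (H.avoid (K : Set V)).Reachable (a i) v) <| by
      rintro i j hij ⟨g, hg, v, hv, hiv⟩ ⟨g', hg', w, hw, hjw⟩
      obtain rfl := hR hg hg'
      by_cases hvw : v = w
      · exact hsep i j hij (hiv.trans (hvw ▸ hjw.symm))
      · obtain rfl := (Sym2.mem_and_mem_iff hvw).1 ⟨hv, hw⟩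
        exact hsep i j hij (hiv.trans ((Adj.reachable (G := H.avoid (K : Set V))
          ⟨hRH _ hg, (hRy _ hg v hv).2, (hRy _ hg w hw).2⟩).trans hjw.symm))
  have hset : ∀ i, (¬ ∃ g ∈ R, ∃ v ∈ g, (H.avoid (K : Set V)).Reachable (a i) v) →
      (H.avoid (K : Set V)).reachSet (a i) = (H'.avoid (K : Set V)).reachSet (a i) := by
    intro i hi
    refine reachSet_congr fun b hb c => ⟨fun hbc => ⟨(hH' b c).2 ⟨Or.inl hbc.1, fun hbR => ?_⟩,
      hbc.2⟩, fun hbc => ⟨((hH' b c).1 hbc.1).1.resolve_right fun hh => ?_, hbc.2⟩⟩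
    · exact hi ⟨_, hbR, b, by simp, hb⟩
    · rcases Sym2.eq_iff.1 hh with hh | hh
      · exact hbc.2.2 (hh.2 ▸ hyK)
      · exact hbc.2.1 (hh.1 ▸ hyK)
  have hadj' : ∀ i, ∃ k ∈ (K : Set V), H'.Adj k (a i) := fun i => by
    obtain ⟨k, hk, hka⟩ := hadj i
    exact ⟨k, hk, (hH' _ _).2 ⟨Or.inl hka, hKR k hk _⟩⟩
  have hsepx : ∀ i, (¬ ∃ g ∈ R, ∃ v ∈ g, (H.avoid (K : Set V)).Reachable (a i) v) →
      ¬ (H'.avoid (K : Set V)).Reachable (a i) x := fun i hi h => by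
    have h' := (Set.ext_iff.1 (hset i hi) x).2 h
    exact hxy ((hya i).trans (Reachable.mono (avoid_le _ _) h')).symm
  have hle : H.avoid (K : Set V)ᶜ ≤ H'.avoid (K : Set V)ᶜ := fun p q hpq =>
    ⟨(hH' p q).2 ⟨Or.inl hpq.1, hKR p (not_not.1 hpq.2.1) q⟩, hpq.2⟩
  refine ⟨K, hyK, fun b hb c hc => (hconn b hb c hc).mono hle,
    isTrifurcating_of_three (hadj' i) (hadj' j)
      ⟨y, hyK, (hH' _ _).2 ⟨Or.inr Sym2.eq_swap, hKR y hyK x⟩⟩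
      (hset i hi ▸ hinf i) (hset j hj ▸ hinf j) (hinfx.mono fun b hb => ?_)
      (fun h => hsep i j hij ((Set.ext_iff.1 (hset i hi) (a j)).2 h)) (hsepx i hi) (hsepx j hj)⟩
  have hxK : ∀ c, H.Reachable x c → c ∉ (K : Set V) := fun c hc hcK =>
    hxy (hc.trans (hyk c hcK).symm)
  exact Reachable.transfer_of_forall hb fun c hc d hcd =>
    ⟨(hH' _ _).2 ⟨Or.inl hcd, hxR c hc d⟩, hxK c hc, hxK d (hc.trans hcd.reachable)⟩

end Modification

/-- On a countable vertex set this writes infiniteness with countable quantifiers, as measurability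
requires. -/
theorem infinite_reachSet_iff {H : SimpleGraph V} {a : V} :
    (H.reachSet a).Infinite ↔ ∀ s : Finset V, ∃ b, b ∉ s ∧ H.Reachable a b := by
  constructor
  · intro h s
    obtain ⟨b, hb, hbs⟩ := h.exists_notMem_finset s
    exact ⟨b, hbs, hb⟩
  · intro h hfin
    obtain ⟨b, hb, hab⟩ := h hfin.toFinset
    exact hb (hfin.mem_toFinset.2 hab)

/-! ### Measurability of the events -/

section Measurability

variable {Ω : Type*} [MeasurableSpace Ω] {H : Ω → SimpleGraph V}

theorem measurable_avoid_adj (hH : ∀ a b, Measurable fun ω => (H ω).Adj a b) (K : Set V) (a b : V) :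
    Measurable fun ω => ((H ω).avoid K).Adj a b :=
  (hH a b).and measurable_const

variable [Countable V]

theorem measurable_reachable (hH : ∀ a b, Measurable fun ω => (H ω).Adj a b) (a b : V) :
    Measurable fun ω => (H ω).Reachable a b := by
  have key : ∀ (n : ℕ) (a b : V), Measurable fun ω => ∃ p : (H ω).Walk a b, p.length = n := by
    intro n
    induction n with
    | zero =>
      intro a b
      have : (fun ω => ∃ p : (H ω).Walk a b, p.length = 0) = fun _ => a = b := by
        funext ω
        refine propext ⟨fun ⟨p, hp⟩ => Walk.eq_of_length_eq_zero hp, ?_⟩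
        rintro rfl
        exact ⟨Walk.nil, rfl⟩
      rw [this]
      exact measurable_const
    | succ n ih =>
      intro a b
      have : (fun ω => ∃ p : (H ω).Walk a b, p.length = n + 1) =
          fun ω => ∃ c, (H ω).Adj a c ∧ ∃ p : (H ω).Walk c b, p.length = n := by
        funext ω
        refine propext ⟨fun ⟨p, hp⟩ => ?_, fun ⟨c, hac, p, hp⟩ =>
          ⟨Walk.cons hac p, by simp [hp]⟩⟩
        cases p with
        | nil => simp at hp
        | cons h p => exact ⟨_, h, p, by simpa using hp⟩
      rw [this]
      exact Measurable.exists fun c => (hH a c).and (ih c b)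
  have : (fun ω => (H ω).Reachable a b) = fun ω => ∃ n, ∃ p : (H ω).Walk a b, p.length = n := by
    funext ω
    exact propext ⟨fun ⟨p⟩ => ⟨_, p, rfl⟩, fun ⟨_, p, _⟩ => ⟨p⟩⟩
  rw [this]
  exact Measurable.exists fun n => key n a b

theorem measurable_infinite_reachSet (hH : ∀ a b, Measurable fun ω => (H ω).Adj a b) (a : V) :
    Measurable fun ω => ((H ω).reachSet a).Infinite := by
  simp_rw [infinite_reachSet_iff]
  exact Measurable.forall fun s => Measurable.exists fun b =>
    measurable_const.and (measurable_reachable hH a b)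

theorem measurable_isTrifurcating (hH : ∀ a b, Measurable fun ω => (H ω).Adj a b) (K : Set V) :
    Measurable fun ω => (H ω).IsTrifurcating K := by
  have hK := measurable_avoid_adj hH K
  refine Measurable.exists fun a => Measurable.and (Measurable.forall fun i =>
    Measurable.exists fun k => measurable_const.and (hH _ _)) (Measurable.and
    (Measurable.forall fun i => measurable_infinite_reachSet hK _)
    (Measurable.forall fun i => Measurable.forall fun j =>
      measurable_const.imp (measurable_reachable hK _ _).not))

theorem measurable_connected (hH : ∀ a b, Measurable fun ω => (H ω).Adj a b) (K : Finset V) :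
    Measurable fun ω => ∀ a ∈ K, ∀ b ∈ K, ((H ω).avoid (K : Set V)ᶜ).Reachable a b :=
  Measurable.forall fun _ => measurable_const.imp (Measurable.forall fun _ =>
    measurable_const.imp (measurable_reachable (measurable_avoid_adj hH _) _ _))

theorem measurable_hasTrifurcation (hH : ∀ a b, Measurable fun ω => (H ω).Adj a b) (y : V) :
    Measurable fun ω => (H ω).HasTrifurcation y :=
  Measurable.exists fun K => measurable_const.and
    ((measurable_connected hH K).and (measurable_isTrifurcating hH _))

theorem measurable_isOneEndedFrom (hH : ∀ a b, Measurable fun ω => (H ω).Adj a b) (v : V) :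
    Measurable fun ω => (H ω).IsOneEndedFrom v := by
  refine (measurable_infinite_reachSet hH v).and (Measurable.forall fun a =>
    (measurable_reachable hH v a).imp (Measurable.forall fun c => Measurable.forall fun d =>
    (hH a c).imp ((hH a d).imp ?_)))
  have hA := measurable_avoid_adj hH {a}
  exact (measurable_infinite_reachSet hA c).imp ((measurable_infinite_reachSet hA d).imp
    measurable_const)

theorem measurable_hasIsolatedEnd (hH : ∀ a b, Measurable fun ω => (H ω).Adj a b) (x : V) :
    Measurable fun ω => (H ω).HasIsolatedEnd x :=
  Measurable.exists fun u => Measurable.exists fun v => (hH u v).and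
    ((measurable_reachable hH x u).and
      ((measurable_reachable (measurable_avoid_adj hH {u}) v x).not.and
        (measurable_isOneEndedFrom (measurable_avoid_adj hH {u}) v)))

theorem measurable_sendsMass (hH : ∀ a b, Measurable fun ω => (H ω).Adj a b) (x z : V) :
    Measurable fun ω => (H ω).SendsMass x z := by
  have hA := measurable_avoid_adj hH {z}
  exact (measurable_isTrifurcating hH _).and (Measurable.exists fun w => (hH z w).and
    ((measurable_infinite_reachSet hA w).and ((Measurable.forall fun t =>
      (measurable_reachable hA w t).imp (measurable_isTrifurcating hH _).not).and
        (measurable_reachable hA w x))))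

end Measurability

/-! ### Mass transport on unimodular quasitransitive graphs -/

section MassTransport

variable {G : SimpleGraph V}

theorem Connected.finite_ball [G.LocallyFinite] (hG : G.Connected) (x : V) (n : ℕ) :
    {y | G.dist x y ≤ n}.Finite := by
  induction n with
  | zero =>
    refine (Set.finite_singleton x).subset fun y hy => ?_
    exact ((hG.preconnected x y).dist_eq_zero_iff.1 (Nat.le_zero.1 hy)).symm
  | succ n ih =>
    refine (ih.union (ih.biUnion (t := fun z => G.neighborSet z) fun z _ =>
      Set.toFinite _)).subset fun y hy => ?_
    rcases Nat.lt_or_ge n (G.dist x y) with h | h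
    · obtain ⟨p, hp⟩ := hG.exists_walk_length_eq_dist y x
      rw [dist_comm] at hp
      cases p with
      | nil => simp at h
      | cons hadj p =>
        refine Or.inr (Set.mem_biUnion (x := _) ?_ hadj.symm)
        have h1 := dist_le p
        rw [dist_comm] at h1
        simp only [Walk.length_cons] at hp
        have h2 : G.dist x y ≤ n + 1 := hy
        change G.dist x _ ≤ n
        omega
    · exact Or.inl h

theorem Connected.countable [G.LocallyFinite] (hG : G.Connected) : Countable V := by
  obtain ⟨x⟩ := hG.nonempty
  rw [← Set.countable_univ_iff, ← show (⋃ n, {y | G.dist x y ≤ n}) = Set.univ from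
    Set.eq_univ_of_forall fun y => Set.mem_iUnion.2 ⟨_, le_refl (G.dist x y)⟩]
  exact Set.countable_iUnion fun n => (hG.finite_ball x n).countable

theorem Connected.dist_iso (hG : G.Connected) (φ : G ≃g G) (a b : V) :
    G.dist (φ a) (φ b) = G.dist a b := by
  have key : ∀ (φ : G ≃g G) (a b : V), G.dist (φ a) (φ b) ≤ G.dist a b := by
    intro φ a b
    obtain ⟨p, hp⟩ := hG.exists_walk_length_eq_dist a b
    rw [← hp, ← Walk.length_map φ.toHom p]
    exact dist_le _
  refine (key φ a b).antisymm ?_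
  simpa using key φ.symm (φ a) (φ b)

/-- The mass transport principle within one orbit of a unimodular graph. -/
theorem mass_transport [G.LocallyFinite] (hG : G.Connected)
    (hunim : RandomForest.IsUnimodular G) (q : V → V → ENNReal)
    (hq : ∀ (φ : G ≃g G) a b, q (φ a) (φ b) = q a b) (x : V) :
    ∑' y, {y | ∃ φ : G ≃g G, φ x = y}.indicator (fun y => q y x) y =
      ∑' y, {y | ∃ φ : G ≃g G, φ x = y}.indicator (q x) y := by
  let S : V → V → Set V := fun x y => {z | ∃ φ : G ≃g G, φ x = x ∧ φ y = z}
  have hSfin : ∀ y, (S x y).Finite := fun y => by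
    refine (hG.finite_ball x (G.dist x y)).subset ?_
    rintro _ ⟨φ, hφ, rfl⟩
    change G.dist x (φ y) ≤ _
    conv_lhs => rw [← hφ]
    exact (hG.dist_iso φ x y).le
  let N : V → ENNReal := fun y => ((S x y).encard : ENNReal)
  have hN0 : ∀ y, N y ≠ 0 := fun y => by
    have : (S x y).Nonempty := ⟨y, Iso.refl, rfl, rfl⟩
    simpa [N] using this.ne_empty
  have hNtop : ∀ y, N y ≠ ⊤ := fun y => by
    simpa [N] using hSfin y
  -- `R y y'` says that an automorphism carries `(y, x)` to `(x, y')`. Summing `q x y' / N y'` over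
  -- all related pairs, by rows or by columns, gives the two sides of the identity.
  let R : V → V → Prop := fun y y' => ∃ φ : G ≃g G, φ y = x ∧ φ x = y'
  have hR1 : ∀ y y', R y y' → {z | R y z} = S x y' := by
    rintro y y' ⟨φ, hφ, rfl⟩
    ext z
    constructor
    · rintro ⟨ψ, hψ, rfl⟩
      exact ⟨φ.symm.trans ψ, by simp [← hφ, hψ], by simp⟩
    · rintro ⟨ψ, hψ, rfl⟩
      exact ⟨φ.trans ψ, by simp [hφ, hψ], by simp⟩
  have hR2 : ∀ y', (∃ φ : G ≃g G, φ x = y') → {y | R y y'}.encard = (S x y').encard := by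
    rintro y' ⟨φ, rfl⟩
    -- Unimodularity enters here: the columns of `R` are in bijection with orbits of the stabilizer
    -- of `φ x`, the rows are orbits of the stabilizer of `x`.
    have h1 : (S x (φ x)).encard = (S (φ x) x).encard := hunim x (φ x) ⟨φ, rfl⟩
    rw [h1, ← φ.injective.encard_image]
    congr 1
    ext z
    constructor
    · rintro ⟨y, ⟨ψ, hψ, hψ'⟩, rfl⟩
      refine ⟨ψ.symm.trans φ, ?_, ?_⟩
      · simp [← hψ']
      · simp [← hψ]
    · rintro ⟨ψ, hψ, rfl⟩
      refine ⟨φ.symm (ψ x), ⟨φ.trans ψ.symm, by simp, ?_⟩, by simp⟩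
      simp only [RelIso.trans_apply]
      conv_lhs => rw [← hψ]
      simp
  have h1 : ∀ y, {y | ∃ φ : G ≃g G, φ x = y}.indicator (fun y => q y x) y =
      ∑' y', {z | R y z}.indicator (fun z => q x z / N z) y' := by
    intro y
    by_cases hy : y ∈ {y | ∃ φ : G ≃g G, φ x = y}
    · rw [Set.indicator_of_mem hy]
      obtain ⟨φ, hφ⟩ := hy
      have hRy : R y (φ.symm x) := ⟨φ.symm, by simp [← hφ], rfl⟩
      have hval : ∀ z ∈ {z | R y z}, q x z / N z = q y x / N (φ.symm x) := by
        rintro z ⟨ψ, hψ, rfl⟩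
        have h2 : N (ψ x) = N (φ.symm x) := by
          simp only [N, ← hR1 _ _ hRy, ← hR1 y (ψ x) ⟨ψ, hψ, rfl⟩]
        rw [h2, ← hq ψ y x, hψ]
      rw [Set.indicator_congr hval, ← tsum_subtype,
        ENNReal.tsum_set_const, hR1 _ _ hRy]
      exact (ENNReal.mul_div_cancel (hN0 _) (hNtop _)).symm
    · rw [Set.indicator_of_notMem hy]
      refine (ENNReal.tsum_eq_zero.2 fun z => Set.indicator_of_notMem ?_ _).symm
      rintro ⟨ψ, hψ, -⟩
      exact hy ⟨ψ.symm, by simp [← hψ]⟩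
  have h2 : ∀ y', ∑' y, {z | R y z}.indicator (fun z => q x z / N z) y' =
      {y | ∃ φ : G ≃g G, φ x = y}.indicator (q x) y' := by
    intro y'
    have h3 : ∀ y, {z | R y z}.indicator (fun z => q x z / N z) y' =
        {y | R y y'}.indicator (fun _ => q x y' / N y') y := fun y => rfl
    rw [tsum_congr h3, ← tsum_subtype, ENNReal.tsum_set_const]
    by_cases hy : y' ∈ {y | ∃ φ : G ≃g G, φ x = y}
    · rw [Set.indicator_of_mem hy, hR2 y' hy]
      exact ENNReal.mul_div_cancel (hN0 _) (hNtop _)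
    · rw [Set.indicator_of_notMem hy]
      have : {y | R y y'} = ∅ := Set.eq_empty_of_forall_notMem fun y ⟨ψ, _, hψ⟩ => hy ⟨ψ, hψ⟩
      simp [this]
  rw [tsum_congr h1, ENNReal.tsum_comm, tsum_congr h2]

/-- On a unimodular quasitransitive graph, an invariant transport sending mass at most one from
each vertex cannot send infinite mass to a vertex. -/
theorem tsum_incoming_ne_top [G.LocallyFinite] (hG : G.Connected)
    (hquasi : RandomForest.IsQuasitransitive G) (hunim : RandomForest.IsUnimodular G)
    (p : V → V → ENNReal) (hp : ∀ (φ : G ≃g G) a b, p (φ a) (φ b) = p a b)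
    (hout : ∀ a, ∑' b, p a b ≤ 1) (z : V) : ∑' a, p a z ≠ ⊤ := by
  classical
  obtain ⟨S, hS, hSV⟩ := hquasi
  -- Every vertex is within `D` of the orbit of `z`, because `S` meets all orbits and is finite.
  let D : ℕ := hS.toFinset.sup fun s => G.dist s z
  let O : Set V := {y | ∃ φ : G ≃g G, φ z = y}
  have hD : ∀ v, ∃ a ∈ O, G.dist a v ≤ D := fun v => by
    obtain ⟨s, hs, φ, rfl⟩ := hSV v
    refine ⟨φ z, ⟨φ, rfl⟩, ?_⟩
    rw [hG.dist_iso, dist_comm]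
    exact Finset.le_sup (f := fun s => G.dist s z) (hS.mem_toFinset.2 hs)
  -- To reduce to a single orbit, `a` forwards the mass sent by all vertices of its `D`-ball. Orbit
  -- points then account for all mass arriving at `z`, and each sends at most the size of its ball.
  let q : V → V → ENNReal := fun a b => ∑' v, {v | G.dist a v ≤ D}.indicator (fun v => p v b) v
  have hq : ∀ (φ : G ≃g G) a b, q (φ a) (φ b) = q a b := by
    intro φ a b
    simp only [q]
    rw [← φ.toEquiv.tsum_eq]
    refine tsum_congr fun v => ?_
    simp only [Set.indicator_apply, Set.mem_ofPred_eq]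
    change (if G.dist (φ a) (φ v) ≤ D then p (φ v) (φ b) else 0) = _
    rw [hG.dist_iso, hp]
  have hmt := mass_transport hG hunim q hq z
  have hin : ∑' v, p v z ≤ ∑' a, O.indicator (fun a => q a z) a := by
    have h1 : ∀ a, O.indicator (fun a => q a z) a =
        ∑' v, if a ∈ O ∧ G.dist a v ≤ D then p v z else 0 := fun a => by
      by_cases ha : a ∈ O
      · simp [ha, q, Set.indicator_apply]
      · simp [ha]
    rw [tsum_congr h1, ENNReal.tsum_comm]
    refine ENNReal.tsum_le_tsum fun v => ?_
    obtain ⟨a, ha, hav⟩ := hD v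
    refine le_trans ?_ (ENNReal.le_tsum a)
    simp [ha, hav]
  have hball := hG.finite_ball z D
  have hout' : ∑' b, O.indicator (q z) b ≤ ({v | G.dist z v ≤ D}.encard : ENNReal) := by
    calc ∑' b, O.indicator (q z) b ≤ ∑' b, q z b :=
          ENNReal.tsum_le_tsum fun b => Set.indicator_le_self _ _ b
      _ = ∑' v, ∑' b, {v | G.dist z v ≤ D}.indicator (fun v => p v b) v := ENNReal.tsum_comm
      _ ≤ ∑' v, {v | G.dist z v ≤ D}.indicator (fun _ => 1) v := by
          refine ENNReal.tsum_le_tsum fun v => ?_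
          by_cases hv : v ∈ {v | G.dist z v ≤ D}
          · simp only [Set.indicator_of_mem hv]
            exact hout v
          · simp [Set.indicator_of_notMem hv]
      _ = _ := by rw [← tsum_subtype, ENNReal.tsum_set_one]
  refine ne_top_of_le_ne_top ?_ (hin.trans (hmt.le.trans hout'))
  simpa using hball

end MassTransport

end SimpleGraph

/-! ### The random forest -/

namespace RandomForest

open SimpleGraph

variable {V : Type*} {G : SimpleGraph V}

theorem graph_adj {ω : Config G} {a b : V} :
    (graph ω).Adj a b ↔ ∃ h : G.Adj a b, (⟨s(a, b), h⟩ : G.edgeSet) ∈ ω := by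
  simp only [graph, fromEdgeSet_adj, Set.mem_image, Subtype.exists, exists_and_right,
    exists_eq_right, mem_edgeSet]
  exact ⟨fun h => h.1, fun h => ⟨h, h.1.ne⟩⟩

theorem graph_le (ω : Config G) : graph ω ≤ G := fun _ _ h => (graph_adj.1 h).1

theorem mem_edgeSet_graph {ω : Config G} {g : G.edgeSet} :
    (g : Sym2 V) ∈ (graph ω).edgeSet ↔ g ∈ ω := by
  obtain ⟨g, hg⟩ := g
  induction g with
  | h a b => exact graph_adj.trans ⟨fun ⟨_, h⟩ => h, fun h => ⟨hg, h⟩⟩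

theorem measurable_graph_adj (a b : V) : Measurable fun ω : Config G => (graph ω).Adj a b := by
  simp_rw [graph_adj]
  by_cases h : G.Adj a b
  · simp only [h, exists_true_left]
    exact measurable_set_mem _
  · simp only [h, IsEmpty.exists_iff]
    exact measurable_const

theorem graph_act_adj (φ : G ≃g G) (ω : Config G) (a b : V) :
    (graph (act φ ω)).Adj (φ a) (φ b) ↔ (graph ω).Adj a b := by
  simp only [graph_adj, act]
  have : ∀ h : G.Adj a b, (⟨s(φ a, φ b), φ.map_adj_iff.2 h⟩ : G.edgeSet) =
      φ.mapEdgeSet ⟨s(a, b), h⟩ := fun h => rfl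
  constructor
  · rintro ⟨h, h'⟩
    refine ⟨φ.map_adj_iff.1 h, ?_⟩
    rwa [this (φ.map_adj_iff.1 h), φ.mapEdgeSet.injective.mem_set_image] at h'
  · rintro ⟨h, h'⟩
    exact ⟨φ.map_adj_iff.2 h, _, h', rfl⟩

theorem isComponentEmbedding_act (φ : G ≃g G) (ω : Config G) :
    IsComponentEmbedding (graph ω) (graph (act φ ω)) φ where
  injective := φ.injective
  adj_iff := graph_act_adj φ ω
  closed _ b _ := φ.surjective b

theorem isComponentEmbedding_act_symm (φ : G ≃g G) (ω : Config G) :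
    IsComponentEmbedding (graph (act φ ω)) (graph ω) φ.symm where
  injective := φ.symm.injective
  adj_iff a b := by
    rw [← graph_act_adj φ ω]
    simp
  closed _ b _ := φ.symm.surjective b

theorem sendsMass_act_iff (φ : G ≃g G) (ω : Config G) (a b : V) :
    (graph (act φ ω)).SendsMass (φ a) (φ b) ↔ (graph ω).SendsMass a b := by
  refine ⟨fun h => ?_, (isComponentEmbedding_act φ ω).sendsMass⟩
  simpa using (isComponentEmbedding_act_symm φ ω).sendsMass h

theorem exists_hasTrifurcation_act_iff (φ : G ≃g G) (ω : Config G) :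
    (∃ y, (graph (act φ ω)).HasTrifurcation y) ↔ ∃ y, (graph ω).HasTrifurcation y :=
  ⟨fun ⟨_, hy⟩ => ⟨_, (isComponentEmbedding_act_symm φ ω).hasTrifurcation hy⟩,
    fun ⟨_, hy⟩ => ⟨_, (isComponentEmbedding_act φ ω).hasTrifurcation hy⟩⟩

theorem graph_surgery_adj {x y : V} (hxy : G.Adj x y) (f : Option G.edgeSet) (ω : Config G)
    (a b : V) : (graph (surgery ⟨s(x, y), hxy⟩ f ω)).Adj a b ↔
      ((graph ω).Adj a b ∨ s(a, b) = s(x, y)) ∧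
        s(a, b) ∉ {g : Sym2 V | ∃ g' : G.edgeSet, f = some g' ∧ (g' : Sym2 V) = g} := by
  simp only [graph_adj, surgery, Set.mem_sdiff, Set.mem_union, Set.mem_singleton_iff,
    Set.mem_ofPred_eq]
  constructor
  · rintro ⟨h, h1, h2⟩
    refine ⟨h1.imp (fun h1 => ⟨h, h1⟩) (fun h1 => congrArg Subtype.val h1), ?_⟩
    rintro ⟨g', hg', hg⟩
    obtain rfl : g' = ⟨s(a, b), h⟩ := Subtype.ext hg
    exact h2 hg'
  · rintro ⟨h1, h2⟩
    have h : G.Adj a b := by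
      rcases h1 with ⟨h, -⟩ | h1
      · exact h
      · rw [← mem_edgeSet, h1]
        exact hxy
    refine ⟨h, h1.imp (fun ⟨_, h1⟩ => h1) (fun h1 => Subtype.ext h1), fun h3 => h2 ⟨_, h3, rfl⟩⟩

variable {P : Measure (Config G)}

/-- Weak insertion tolerance moves an event of positive probability into an event of positive
probability. -/
theorem IsWeaklyInsertionTolerant.measure_pos (hwit : IsWeaklyInsertionTolerant P) {x y : V}
    (hxy : G.Adj x y) (r : ℕ) {A B : Set (Config G)} (hA : MeasurableSet A) (hPA : P A ≠ 0)
    (hAxy : ∀ ω ∈ A, ¬ (graph ω).Reachable x y)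
    (hB : ∀ ω ∈ A, ∀ f : Option G.edgeSet, (∀ g : G.edgeSet, f = some g →
      g ∈ ω ∧ ∀ v ∈ (g : Sym2 V), (graph ω).Reachable x v ∧ r < G.dist x v) →
      surgery ⟨s(x, y), hxy⟩ f ω ∈ B) : P B ≠ 0 := by
  obtain ⟨f, -, hpos, hf⟩ := hwit x y hxy r
  -- Removing a measurable null set makes the description of `f` hold pointwise, while the event
  -- stays measurable as insertion tolerance requires.
  obtain ⟨S, hS, hSm, hPS⟩ := exists_measurable_superset_of_null (ae_iff.1 hf)
  have hAS : P (A \ S) = P A := measure_sdiff_null hPS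
  have := hpos (A \ S) (hA.diff hSm) (by rw [hAS]; exact pos_iff_ne_zero.2 hPA)
    (ae_of_all _ fun ω hω => hAxy ω hω.1)
  refine (this.trans_le (measure_mono ?_)).ne'
  rintro _ ⟨ω, hω, rfl⟩
  exact hB ω hω.1 (f ω) ((not_not.1 fun h => hω.2 (hS h)) (hAxy ω hω.1))

section

variable [G.LocallyFinite] [IsProbabilityMeasure P]

/-- The expected mass received by `z` is finite by mass transport, so Borel–Cantelli makes the set
of senders almost surely finite. -/
theorem ae_finite_sendsMass (hconn : G.Connected) (hquasi : IsQuasitransitive G)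
    (hunim : IsUnimodular G) (hergodic : IsErgodic P) :
    ∀ᵐ ω ∂P, ∀ z, {x | (graph ω).SendsMass x z}.Finite := by
  have := hconn.countable
  have hmeas : ∀ a b, MeasurableSet {ω : Config G | (graph ω).SendsMass a b} := fun a b =>
    measurableSet_setOfPred.2 (measurable_sendsMass measurable_graph_adj a b)
  refine ae_all_iff.2 fun z => ae_finite_setOfPred_mem
    (s := fun x => {ω : Config G | (graph ω).SendsMass x z})
    (tsum_incoming_ne_top hconn hquasi hunim
      (fun a b => P {ω : Config G | (graph ω).SendsMass a b}) (fun φ a b => ?_) (fun a => ?_) z)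
  · rw [← (hergodic.invariant φ).measure_preimage (hmeas (φ a) (φ b)).nullMeasurableSet]
    congr 1
    ext ω
    exact sendsMass_act_iff φ ω a b
  · refine (tsum_meas_le_meas_iUnion_of_disjoint P (fun b => hmeas a b) fun b c hbc =>
      Set.disjoint_left.2 fun ω hb hc => hbc (SendsMass.unique hb hc)).trans prob_le_one

/-- Almost surely, a component with a trifurcation has no isolated end. -/
theorem ae_not_reachable (hconn : G.Connected) (hquasi : IsQuasitransitive G)
    (hunim : IsUnimodular G) (hforest : IsSpanningForest P) (hergodic : IsErgodic P) :
    ∀ᵐ ω ∂P, ∀ x y, (graph ω).HasIsolatedEnd x → (graph ω).HasTrifurcation y →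
      ¬ (graph ω).Reachable x y := by
  filter_upwards [hforest, ae_finite_sendsMass hconn hquasi hunim hergodic] with ω hω hfin x y hx hy
    hxy
  obtain ⟨z, hz⟩ := hω.exists_infinite_sendsMass hx hy hxy
  exact hz (hfin z)

/-- No component with an isolated end is adjacent in `G` to one with a trifurcation. -/
theorem measure_adj_eq_zero (hconn : G.Connected) (hquasi : IsQuasitransitive G)
    (hunim : IsUnimodular G) (hforest : IsSpanningForest P) (hergodic : IsErgodic P)
    (hwit : IsWeaklyInsertionTolerant P) {x y : V} (hxy : G.Adj x y) :
    P {ω | (graph ω).HasIsolatedEnd x ∧ (graph ω).HasTrifurcation y} = 0 := by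
  classical
  have := hconn.countable
  have hae := ae_not_reachable hconn hquasi hunim hforest hergodic
  have hnull : P {ω | (graph ω).HasIsolatedEnd x ∧ (graph ω).HasTrifurcation y ∧
      (graph ω).Reachable x y} = 0 := by
    refine measure_mono_null ?_ (ae_iff.1 hae)
    exact fun ω hω h => h x y hω.1 hω.2.1 hω.2.2
  -- Fixing one of the countably many `K` allows a radius independent of `ω`.
  have hK : ∀ K : Finset V, y ∈ K → P {ω | ¬ (graph ω).Reachable y x ∧
      (graph ω).HasIsolatedEnd x ∧
      (∀ a ∈ K, ∀ b ∈ K, ((graph ω).avoid (K : Set V)ᶜ).Reachable a b) ∧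
      (graph ω).IsTrifurcating K} = 0 := by
    intro K hyK
    by_contra hpos
    -- The edge is oriented so that the deletion happens in the component of `y`, leaving that of
    -- `x` intact; the radius keeps the deleted edge off `K`.
    refine hwit.measure_pos hxy.symm (K.sup fun k => G.dist y k) (measurableSet_setOfPred.2
      ((measurable_reachable measurable_graph_adj y x).not.and
        ((measurable_hasIsolatedEnd measurable_graph_adj x).and
          ((measurable_connected measurable_graph_adj K).and
            (measurable_isTrifurcating measurable_graph_adj K))))) hpos (fun ω hω => hω.1) ?_ hnull
    rintro ω ⟨hyx, hx, hKconn, hKtri⟩ f hf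
    have hadj := graph_surgery_adj hxy.symm f ω
    set R : Set (Sym2 V) := {g | ∃ g' : G.edgeSet, f = some g' ∧ (g' : Sym2 V) = g} with hR
    have hRsub : R.Subsingleton := by
      rintro _ ⟨g, hg, rfl⟩ _ ⟨g', hg', rfl⟩
      rw [Option.some.inj (hg.symm.trans hg')]
    have hRH : ∀ g ∈ R, g ∈ (graph ω).edgeSet := by
      rintro _ ⟨g, hg, rfl⟩
      exact mem_edgeSet_graph.2 (hf g hg).1
    have hRy : ∀ g ∈ R, ∀ v ∈ g, (graph ω).Reachable y v ∧ v ∉ K := by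
      rintro _ ⟨g, hg, rfl⟩ v hv
      obtain ⟨h1, h2⟩ := (hf g hg).2 v hv
      exact ⟨h1, fun hvK => h2.not_ge (Finset.le_sup (f := fun k => G.dist y k) hvK)⟩
    have hxR : ∀ b, (graph ω).Reachable x b → ∀ c, s(b, c) ∉ R := fun b hb c hbR =>
      hyx ((hRy _ hbR b (by simp)).1.trans hb.symm)
    have htri := hKtri.attach_infinite hyK hKconn (fun h => hyx h.symm) hx.infinite hRsub hRH hRy
      (H' := graph (surgery ⟨s(y, x), hxy.symm⟩ f ω)) fun a b => by rw [hadj, Sym2.eq_swap (a := x)]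
    have hend := hx.congr (H' := graph (surgery ⟨s(y, x), hxy.symm⟩ f ω))
      (fun b hb c hbc => (hadj b c).2 ⟨Or.inl hbc, hxR b hb c⟩) fun b hb hbx c hbc => by
        refine ((hadj b c).1 hbc).1.resolve_right fun h => ?_
        rcases Sym2.eq_iff.1 h with h | h
        · exact hyx (h.1 ▸ hb.symm)
        · exact hbx h.1
    exact ⟨hend, htri, (Adj.reachable ((hadj y x).2 ⟨Or.inr rfl, fun h =>
      (hRy _ h y (by simp)).2 hyK⟩)).symm⟩
  refine measure_mono_null (fun ω hω => ?_) (measure_union_null hnull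
    (measure_iUnion_null fun K : Finset V => measure_iUnion_null fun h : y ∈ K => hK K h))
  obtain ⟨hx, hy⟩ := hω
  by_cases hr : (graph ω).Reachable x y
  · exact Or.inl ⟨hx, hy, hr⟩
  · obtain ⟨K, hyK, hK1, hK2⟩ := hy
    exact Or.inr (Set.mem_iUnion₂.2 ⟨K, hyK, fun h => hr h.symm, hx, hK1, hK2⟩)

/-- If `y` has a neighbour `q` in a finite component, then `q` may replace `y`. -/
theorem measure_finite_eq_zero (hconn : G.Connected) (hquasi : IsQuasitransitive G)
    (hunim : IsUnimodular G) (hforest : IsSpanningForest P) (hergodic : IsErgodic P)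
    (hwit : IsWeaklyInsertionTolerant P) {x y q : V} (hqy : G.Adj q y)
    (hnull : P {ω | (graph ω).HasIsolatedEnd x ∧ (graph ω).HasTrifurcation q} = 0) :
    P {ω | ((graph ω).HasIsolatedEnd x ∧ (graph ω).HasTrifurcation y) ∧
      ((graph ω).reachSet q).Finite} = 0 := by
  classical
  have := hconn.countable
  have hae := ae_not_reachable hconn hquasi hunim hforest hergodic
  have hF : ∀ F : Finset V, P {ω | ¬ (graph ω).Reachable x y ∧ (graph ω).HasIsolatedEnd x ∧
      (graph ω).HasTrifurcation y ∧ ∀ b, (graph ω).Reachable q b → b ∈ F} = 0 := by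
    intro F
    by_contra hpos
    -- The deletion takes place on the side of `q`, whose component lies in `F` and thus within the
    -- radius. No edge is available, so `f` must be `none`.
    refine hwit.measure_pos hqy (F.sup fun k => G.dist q k) (measurableSet_setOfPred.2
      ((measurable_reachable measurable_graph_adj x y).not.and
        ((measurable_hasIsolatedEnd measurable_graph_adj x).and
          ((measurable_hasTrifurcation measurable_graph_adj y).and
            (Measurable.forall fun b => (measurable_reachable measurable_graph_adj q b).imp
              measurable_const))))) hpos ?_ ?_ hnull
    · rintro ω ⟨-, -, hy, hqF⟩ hqy'
      exact hy.infinite (F.finite_toSet.subset fun b hb => hqF b (hqy'.trans hb))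
    rintro ω ⟨hxy, hx, hy, hqF⟩ f hf
    have hnone : f = none := by
      refine Option.eq_none_iff_forall_ne_some.2 fun g hg => ?_
      obtain ⟨-, h2⟩ := hf g hg
      have hv := Sym2.out_fst_mem (g : Sym2 V)
      exact (h2 _ hv).2.not_ge (Finset.le_sup (f := fun k => G.dist q k) (hqF _ (h2 _ hv).1))
    have hfin : ((graph ω).reachSet q).Finite := F.finite_toSet.subset fun b hb => hqF b hb
    have hadj : ∀ a b, (graph (surgery ⟨s(q, y), hqy⟩ f ω)).Adj a b ↔
        (graph ω).Adj a b ∨ s(a, b) = s(q, y) := fun a b => by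
      rw [graph_surgery_adj hqy f ω, and_iff_left]
      rintro ⟨g, hg, -⟩
      simp [hnone] at hg
    refine ⟨hx.congr (fun b _ c hbc => (hadj b c).2 (Or.inl hbc)) fun b hb _ c hbc =>
      ((hadj b c).1 hbc).resolve_right fun h => ?_, hy.attach_finite hqy.ne' hfin hadj⟩
    rcases Sym2.eq_iff.1 h with h | h
    · exact hx.infinite (hfin.subset fun c hc => (h.1 ▸ hb).symm.trans hc)
    · exact hxy (h.1 ▸ hb)
  refine measure_mono_null (fun ω hω => ?_) (measure_union_null (ae_iff.1 hae)
    (measure_iUnion_null hF))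
  obtain ⟨⟨hx, hy⟩, hq⟩ := hω
  by_cases hr : (graph ω).Reachable x y
  · exact Or.inl fun h => h x y hx hy hr
  · exact Or.inr (Set.mem_iUnion.2 ⟨hq.toFinset, hr, hx, hy, fun b hb => hq.mem_toFinset.2 hb⟩)

/-- An infinite component yields a trifurcation or an isolated end according to whether it has
infinitely many ends. -/
theorem finite_or_hasIsolatedEnd_or_hasTrifurcation {ω : Config G} (hω : (graph ω).IsAcyclic)
    (q : V) : ((graph ω).reachSet q).Finite ∨ (graph ω).HasIsolatedEnd q ∨
      (graph ω).HasTrifurcation q := by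
  let C := (graph ω).connectedComponentMk q
  have hC : C.supp = (graph ω).reachSet q := by
    ext b
    exact ⟨fun h => (ConnectedComponent.exact h).symm, fun h => ConnectedComponent.sound h.symm⟩
  by_cases hfin : ((graph ω).reachSet q).Finite
  · exact Or.inl hfin
  refine Or.inr ?_
  by_cases h : C.toSimpleGraph.end.Infinite
  · exact Or.inr (C.hasTrifurcation rfl h)
  · exact Or.inl (hω.hasIsolatedEnd (fun v => (Set.toFinite (G.neighborSet v)).subset
      fun w hw => graph_le ω hw) C rfl (hC ▸ hfin) h)

/-- Almost surely, components with isolated ends and components with trifurcations do not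
coexist. -/
theorem measure_coexistence_eq_zero (hconn : G.Connected) (hquasi : IsQuasitransitive G)
    (hunim : IsUnimodular G) (hforest : IsSpanningForest P) (hergodic : IsErgodic P)
    (hwit : IsWeaklyInsertionTolerant P) (n : ℕ) : ∀ x y : V, G.dist x y = n →
    P {ω | (graph ω).HasIsolatedEnd x ∧ (graph ω).HasTrifurcation y} = 0 := by
  have hae := ae_not_reachable hconn hquasi hunim hforest hergodic
  induction n with
  | zero =>
    intro x y hd
    obtain rfl := (hconn.preconnected x y).dist_eq_zero_iff.1 hd
    refine measure_mono_null ?_ (ae_iff.1 hae)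
    exact fun ω hω h => h x x hω.1 hω.2 .rfl
  | succ n ih =>
    intro x y hd
    obtain ⟨p, hp⟩ := hconn.exists_walk_length_eq_dist y x
    rw [SimpleGraph.dist_comm, hd] at hp
    cases p with
    | nil => simp at hp
    | @cons _ q _ hyq p =>
      have hqn : G.dist x q = n := by
        have h1 := dist_le p
        have h2 := hconn.dist_triangle (u := x) (v := q) (w := y)
        rw [SimpleGraph.dist_comm] at h1
        simp only [Walk.length_cons] at hp
        have h3 : G.dist q y = 1 := dist_eq_one_iff_adj.2 hyq.symm
        omega
      have h1 := ih x q hqn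
      refine measure_mono_null (fun ω hω => ?_) (measure_union_null (ae_iff.1 hforest)
        (measure_union_null h1 (measure_union_null
          (measure_adj_eq_zero hconn hquasi hunim hforest hergodic hwit hyq.symm)
          (measure_finite_eq_zero hconn hquasi hunim hforest hergodic hwit hyq.symm h1))))
      -- The component of `q` decides: if finite, it can be glued to `y`; with an isolated end, `q`
      -- and `y` form an adjacent pair; with a trifurcation, `x` and `q` are covered by induction.
      by_cases hac : (graph ω).IsAcyclic
      · rcases finite_or_hasIsolatedEnd_or_hasTrifurcation hac q with h | h | h
        · exact Or.inr (Or.inr (Or.inr ⟨hω, h⟩))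
        · exact Or.inr (Or.inr (Or.inl ⟨h, hω.2⟩))
        · exact Or.inr (Or.inl ⟨hω.1, h⟩)
      · exact Or.inl hac

end

end RandomForest

/-! ### Ergodicity and conclusion -/

theorem theorem3p1 {V : Type*} (G : SimpleGraph V) [G.LocallyFinite] (hconn : G.Connected)
    (hquasi : RandomForest.IsQuasitransitive G) (hunim : RandomForest.IsUnimodular G)
    (P : Measure (RandomForest.Config G)) [IsProbabilityMeasure P]
    (hforest : RandomForest.IsSpanningForest P)
    (hergodic : RandomForest.IsErgodic P)
    (hwit : RandomForest.IsWeaklyInsertionTolerant P)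
    (hends : 0 < P {ω | ∃ C : (RandomForest.graph ω).ConnectedComponent,
      RandomForest.HasInfinitelyManyEnds C}) :
    ∀ᵐ ω ∂P, ∀ C : (RandomForest.graph ω).ConnectedComponent,
      C.supp.Infinite → RandomForest.HasInfinitelyManyEnds C := by
  have := hconn.countable
  -- Having infinitely many ends is replaced by the weaker event of having a trifurcation, which is
  -- visibly measurable and invariant, so the zero-one law applies.
  set A : Set (RandomForest.Config G) := {ω | ∃ y, (RandomForest.graph ω).HasTrifurcation y} with hA
  have hAm : MeasurableSet A := measurableSet_setOfPred.2 (Measurable.exists fun y =>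
    SimpleGraph.measurable_hasTrifurcation RandomForest.measurable_graph_adj y)
  have hA0 : P A ≠ 0 := by
    refine (hends.trans_le (measure_mono ?_)).ne'
    rintro ω ⟨C, hC⟩
    obtain ⟨y, hy⟩ := C.nonempty_supp
    exact ⟨y, C.hasTrifurcation hy hC⟩
  have hA1 : P A = 1 := (hergodic.zero_or_one A hAm fun φ => Set.ext fun ω =>
    RandomForest.exists_hasTrifurcation_act_iff φ ω).resolve_left hA0
  have hAae : ∀ᵐ ω ∂P, ω ∈ A := (prob_compl_eq_zero_iff hAm).2 hA1
  have hno : ∀ᵐ ω ∂P, ∀ x y, ¬ ((RandomForest.graph ω).HasIsolatedEnd x ∧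
      (RandomForest.graph ω).HasTrifurcation y) :=
    ae_all_iff.2 fun x => ae_all_iff.2 fun y => measure_eq_zero_iff_ae_notMem.1
      (RandomForest.measure_coexistence_eq_zero hconn hquasi hunim hforest hergodic hwit _ x y rfl)
  filter_upwards [hforest, hAae, hno] with ω hω ⟨y, hy⟩ hω' C hC
  by_contra hCends
  obtain ⟨x, hx⟩ := C.nonempty_supp
  exact hω' x y ⟨hω.hasIsolatedEnd (fun v => (Set.toFinite (G.neighborSet v)).subset
    fun w hw => RandomForest.graph_le ω hw) C hx hC hCends, hy⟩
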